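/- A $3$-graph $G$ is a $3$-uniform hypergraph with finite vertex set $V(G)$; $v(G)=|V(G)|$. For $q\ge 1$ let $r(G;q)$ be the least $N$ such that every colouring with $q$ colours of the triples of an $N$-element set contains a monochromatic, not necessarily induced, copy of $G$. A set $U\subseteq V(G)$ with $2\le |U|<v(G)$ is collapsible if no edge of $G$ meets $U$ in exactly two vertices. Collapsing $U$ then gives the $3$-graph $H$ on $(V(G)\setminus U)\cup\{v^*\}$, where $v^*$ is a new vertex, whose edges are the edges of $G$ disjoint from $U$ together with all triples $xyv^*$ such that $x,y\in V(G)\setminus U$ and $xyu\in E(G)$ for some $u\in U$; we say that $G$ is reducible to the pair $(H,G[U])$. Let $\mathcal U_0$ be the set of tripartite $3$-graphs (those with a partition of the vertices into three parts such that every edge has one vertex in each part). Let $\mathcal U_1$ be the set of $3$-graphs that have a set of vertices meeting every edge in exactly one vertex. For $i\ge 2$ define $\mathcal U_i$ by recursion on the number of vertices: $G\in\mathcal U_i$ if and only if $G\in\mathcal U_{i-1}$ or $G$ is reducible to some pair $(H,F)$ with $H\in\mathcal U_{i-1}$ and $F\in\mathcal U_i$. Let $\mathcal U=\bigcup_{i\ge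 0}\mathcal U_i$. Theorem. Let $G$ be a fixed $3$-graph with at least two edges. Then $r(G;q)$ is finite for every $q\ge 1$, and the following hold. (a) If $G\in\mathcal U_0$, then there are constants $c,C>0$, depending only on $G$, such that $q^{c}\le r(G;q)\le q^{C}$ for all $q\ge 2$. (b) If $G\in\mathcal U\setminus\mathcal U_0$, then there are constants $c,C>0$, depending only on $G$, such that $2^{cq}\le r(G;q)\le 2^{q^{C}}$ for all $q\ge 2$. More precisely, for every $\ell\ge 0$, if $G\in\mathcal U_\ell$, then there is a constant $C>0$, depending only on $G$ and $\ell$, such that $r(G;q)\le 2^{C q^{\ell}\log q}$ for all $q\ge 2$. (c) If $G\notin\mathcal U$, then $2^{2^{q/2}}\le r(G;q)$ for all $q\ge 1$, and there is a constant $C>0$, depending only on $G$, such that $r(G;q)\le 2^{2^{C q\log q}}$ for all $q\ge 2$. -/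

import Mathlib

universe u

/-- A `3`-uniform hypergraph on the vertex set `V`: a set of `3`-element subsets of `V`. -/
structure ThreeGraph (V : Type u) where
  /-- The edges. -/
  edges : Set (Finset V)
  /-- Every edge has exactly three vertices. -/
  card_edge : ∀ e ∈ edges, e.card = 3

namespace ThreeGraph

variable {V : Type u}

/-- `V` splits into three parts so that every edge has one vertex in each part. -/
def IsTripartite (G : ThreeGraph V) : Prop :=
  ∃ part : V → Fin 3, ∀ e ∈ G.edges, Set.InjOn part (e : Set V)

/-- Some set of vertices intersects every edge in exactly one vertex. -/
def HasExactTransversal (G : ThreeGraph V) : Prop :=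
  ∃ S : Set V, ∀ e ∈ G.edges, ((e : Set V) ∩ S).ncard = 1

/-- `U` is collapsible: `2 ≤ |U| < |V|` and no edge meets `U` in exactly two vertices. -/
def IsCollapsible (G : ThreeGraph V) (U : Set V) : Prop :=
  2 ≤ U.ncard ∧ U.ncard < Nat.card V ∧ ∀ e ∈ G.edges, ((e : Set V) ∩ U).ncard ≠ 2

/-- The induced subgraph `G[U]`. -/
def induce (G : ThreeGraph V) (U : Set V) : ThreeGraph U where
  edges := {e | e.map (Function.Embedding.subtype _) ∈ G.edges}
  card_edge := fun e he => by
    have h := G.card_edge _ he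
    rwa [Finset.card_map] at h

open Classical in
/-- The map that sends all of `U` to the new vertex `none` and fixes the vertices outside `U`. -/
noncomputable def collapseMap (U : Set V) (v : V) : Option {v : V // v ∉ U} :=
  if h : v ∈ U then none else some ⟨v, h⟩

/-- The `3`-graph obtained from `G` by collapsing `U` to the new vertex `none`. The images of
size three are those of the edges that meet `U` in at most one vertex. -/
def collapse (G : ThreeGraph V) (U : Set V) : ThreeGraph (Option {v : V // v ∉ U}) where
  edges := {e | e.card = 3 ∧
    ∃ f ∈ G.edges, (e : Set (Option {v : V // v ∉ U})) = collapseMap U '' (f : Set V)}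
  card_edge := fun _ he => he.1

/-- The closure of a family `P` of `3`-graphs: it contains `P` and every `G` that is reducible to
a pair `(H, F)` with `H` in `P` and `F` in the closure itself. For finite `3`-graphs `F` has fewer
vertices than `G`, so there is only one family that satisfies this recursive description. -/
inductive RedClosure (P : ∀ W : Type u, ThreeGraph W → Prop) :
    ∀ W : Type u, ThreeGraph W → Prop
  | base (W : Type u) (G : ThreeGraph W) (h : P W G) : RedClosure P W G
  | reduce (W : Type u) (G : ThreeGraph W) (U : Set W) (hU : G.IsCollapsible U)
      (hH : P _ (G.collapse U)) (hF : RedClosure P _ (G.induce U)) : RedClosure P W G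

/-- The family `𝒰_ℓ`, as a predicate on `3`-graphs. -/
def ULevel : ℕ → ∀ W : Type u, ThreeGraph W → Prop
  | 0 => fun _ G => G.IsTripartite
  | 1 => fun _ G => G.HasExactTransversal
  | (i + 2) => RedClosure (ULevel (i + 1))

/-- `G` belongs to `𝒰_ℓ`. -/
def InULevel (G : ThreeGraph V) (ℓ : ℕ) : Prop :=
  ULevel ℓ V G

/-- Membership in `𝒰`, the union of all `𝒰_ℓ`. -/
def InU (G : ThreeGraph V) : Prop :=
  ∃ ℓ : ℕ, G.InULevel ℓ

/-- The coloring `χ` of the triples of `Fin N` contains a monochromatic (not necessarily induced)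
copy of `G`. -/
def HasMonoCopy (G : ThreeGraph V) {N q : ℕ}
    (χ : {s : Finset (Fin N) // s.card = 3} → Fin q) : Prop :=
  ∃ (c : Fin q) (φ : V ↪ Fin N), ∀ (e : Finset V) (he : e ∈ G.edges),
    χ ⟨e.map φ, (Finset.card_map φ).trans (G.card_edge e he)⟩ = c

/-- Every `q`-coloring of the triples of an `N`-element set has a monochromatic copy of `G`. -/
def Arrows (G : ThreeGraph V) (q N : ℕ) : Prop :=
  ∀ χ : {s : Finset (Fin N) // s.card = 3} → Fin q, G.HasMonoCopy χ

/-- The `q`-color Ramsey number `r(G; q)`, the least `N` with `G.Arrows q N`. -/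
noncomputable def ramseyNumber (G : ThreeGraph V) (q : ℕ) : ℕ :=
  sInf {N : ℕ | G.Arrows q N}

end ThreeGraph

namespace ThreeGraph

/-! ### Off-diagonal arrows and blowing up a vertex -/

/-- Every coloring of the triples of a set of at least `N` vertices by `Fin q` has, for some
color `c`, a copy of `T c` all of whose edges have color `c`. -/
def OffDiagArrows {q : ℕ} (T : Fin q → Σ W : Type u, ThreeGraph W) (N : ℕ) : Prop :=
  ∀ (X : Type) [Fintype X] (χ : Finset X → Fin q), N ≤ Fintype.card X →
    ∃ c, ∃ φ : (T c).1 ↪ X, ∀ e ∈ (T c).2.edges, χ (e.map φ) = c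

theorem OffDiagArrows.mono {q : ℕ} {T : Fin q → Σ W : Type u, ThreeGraph W} {M N : ℕ}
    (h : OffDiagArrows T M) (hMN : M ≤ N) : OffDiagArrows T N :=
  fun X _ χ hX => h X χ (hMN.trans hX)

/-- Double pigeonhole over the transversals of `M` blocks. A transversal's type is the colour of its
copy together with the blocks used; there are at most `q * M ^ h` types. Within one popular type,
fixing the choices in all blocks except that of `v c` still leaves `n` transversals. -/
theorem OffDiagArrows.exists_large_fiber {q : ℕ} {T : Fin q → Σ W : Type u, ThreeGraph W}
    {M h n : ℕ} (hT : OffDiagArrows T M) (hfin : ∀ c, Finite (T c).1)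
    (hcard : ∀ c, Nat.card (T c).1 ≤ h) (v : ∀ c, (T c).1) (hM : 0 < M) (hn : 0 < n)
    (X : Type) [Fintype X] (χ : Finset X → Fin q) (hX : M * (q * M ^ h * n) ≤ Fintype.card X) :
    ∃ c, ∃ φ : (T c).1 → X, ∃ Y : Finset X, n ≤ Y.card ∧ ∀ y ∈ Y, ∃ ψ : (T c).1 ↪ X,
      ψ (v c) = y ∧ (∀ w, w ≠ v c → ψ w = φ w) ∧ ∀ e ∈ (T c).2.edges, χ (e.map ψ) = c := by
  classical
  have : ∀ c, Fintype (T c).1 := fun c => Fintype.ofFinite _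
  have hq : 0 < q := (χ ∅).pos
  set P := q * M ^ h with hP
  have hP0 : 0 < P := by positivity
  set L := P * n with hL
  have hL0 : 0 < L := by positivity
  -- `ι` lays out `M` disjoint blocks of size `L`; `s g` is the transversal picking the point `g i`
  -- of block `i`.
  obtain ⟨ι⟩ : Nonempty (Fin M × Fin L ↪ X) :=
    Function.Embedding.nonempty_of_card_le (by simpa using hX)
  let s : (Fin M → Fin L) → (Fin M ↪ X) := fun g =>
    ⟨fun i => ι (i, g i), fun i j hij => congrArg Prod.fst (ι.injective hij)⟩
  have hcopy : ∀ g : Fin M → Fin L, ∃ k : Σ c, (T c).1 → Fin M, ∃ hk : Function.Injective k.2,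
      ∀ e ∈ (T k.1).2.edges, χ (e.map ((⟨k.2, hk⟩ : (T k.1).1 ↪ Fin M).trans (s g))) = k.1 := by
    intro g
    obtain ⟨c, φ, hφ⟩ := hT (Fin M) (fun e => χ (e.map (s g))) (by simp)
    refine ⟨⟨c, φ⟩, φ.injective, fun e he => ?_⟩
    rw [← Finset.map_map]
    exact hφ e he
  choose k hkinj hk using hcopy
  have hK : Fintype.card (Σ c, (T c).1 → Fin M) ≤ P := by
    rw [Fintype.card_sigma, hP]
    calc ∑ c, Fintype.card ((T c).1 → Fin M) ≤ ∑ _c : Fin q, M ^ h := by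
          refine Finset.sum_le_sum fun c _ => ?_
          rw [Fintype.card_fun, Fintype.card_fin, ← Nat.card_eq_fintype_card (α := (T c).1)]
          exact Nat.pow_le_pow_right hM (hcard c)
      _ = q * M ^ h := by simp
  have hLM : L ^ M = L ^ (M - 1) * L := by rw [← pow_succ, Nat.sub_add_cancel hM]
  obtain ⟨k₀, -, hk₀⟩ := Finset.exists_le_card_fiber_of_mul_le_card_of_maps_to
    (s := (Finset.univ : Finset (Fin M → Fin L))) (t := Finset.univ) (f := k)
    (n := n * L ^ (M - 1)) (fun _ _ => Finset.mem_univ _) ⟨k (fun _ => ⟨0, hL0⟩), by simp⟩ (by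
      rw [Finset.card_univ, Finset.card_univ, Fintype.card_fun, Fintype.card_fin, Fintype.card_fin,
        hLM]
      calc _ ≤ P * (n * L ^ (M - 1)) := Nat.mul_le_mul_right _ hK
        _ = L ^ (M - 1) * L := by rw [hL]; ring)
  obtain ⟨c, κ⟩ := k₀
  -- Only the choice in block `b` moves the image of `v c`, so the other coordinates are frozen
  -- next.
  set b := κ (v c) with hb
  obtain ⟨r, -, hr⟩ := Finset.exists_le_card_fiber_of_mul_le_card_of_maps_to
    (s := Finset.univ.filter fun g => k g = ⟨c, κ⟩)
    (t := (Finset.univ : Finset ({i : Fin M // i ≠ b} → Fin L)))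
    (f := fun g i => g i.1) (n := n) (fun _ _ => Finset.mem_univ _)
    ⟨fun _ => ⟨0, hL0⟩, by simp⟩ (by
      rw [Finset.card_univ, Fintype.card_fun, Fintype.card_fin, Fintype.card_subtype_compl,
        Fintype.card_fin, Fintype.card_subtype_eq, mul_comm]
      exact hk₀)
  set S := (Finset.univ.filter fun g => k g = ⟨c, κ⟩).filter
    fun g => (fun i : {i : Fin M // i ≠ b} => g i.1) = r with hS
  refine ⟨c, fun w => if hw : κ w ≠ b then ι (κ w, r ⟨κ w, hw⟩) else ι (b, ⟨0, hL0⟩),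
    S.image fun g => ι (b, g b), ?_, ?_⟩
  · rw [Finset.card_image_of_injOn]
    · exact hr
    · intro g hg g' hg' hgg
      have h1 : g b = g' b := congrArg Prod.snd (ι.injective hgg)
      have hg2 := (Finset.mem_filter.1 hg).2
      have hg2' := (Finset.mem_filter.1 hg').2
      funext i
      by_cases hi : i = b
      · rw [hi, h1]
      · exact congrFun (hg2.trans hg2'.symm) ⟨i, hi⟩
  · intro y hy
    obtain ⟨g, hg, rfl⟩ := Finset.mem_image.1 hy
    have hg2 := (Finset.mem_filter.1 hg).2
    have hg1 := (Finset.mem_filter.1 (Finset.mem_filter.1 hg).1).2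
    have hcopy : ∃ hk : Function.Injective (k g).2, ∀ e ∈ (T (k g).1).2.edges,
        χ (e.map ((⟨(k g).2, hk⟩ : (T (k g).1).1 ↪ Fin M).trans (s g))) = (k g).1 :=
      ⟨hkinj g, hk g⟩
    rw [hg1] at hcopy
    obtain ⟨hinj, hcol⟩ := hcopy
    refine ⟨(⟨κ, hinj⟩ : (T c).1 ↪ Fin M).trans (s g), rfl, fun w hw => ?_, hcol⟩
    have hne : κ w ≠ b := fun h => hw (hinj h)
    simp only [hne, ne_eq, not_false_eq_true, dite_true]
    rw [← hg2]
    rfl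

/-- Many copies of `H` in color `c` that differ only in the image of one vertex yield, for some
color `c'`, a copy of `T c'` in color `c'`. -/
def BlowsUp {q : ℕ} (T : Fin q → Σ W : Type u, ThreeGraph W) (n : ℕ) (c : Fin q)
    (H : Σ W : Type u, ThreeGraph W) : Prop :=
  ∃ v : H.1, ∀ (X : Type) [Fintype X] (χ : Finset X → Fin q) (φ : H.1 → X) (Y : Finset X),
    n ≤ Y.card → (∀ y ∈ Y, ∃ ψ : H.1 ↪ X,
      ψ v = y ∧ (∀ w, w ≠ v → ψ w = φ w) ∧ ∀ e ∈ H.2.edges, χ (e.map ψ) = c) →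
    ∃ c', ∃ φ' : (T c').1 ↪ X, ∀ e ∈ (T c').2.edges, χ (e.map φ') = c'

theorem OffDiagArrows.of_blowsUp {q : ℕ} {T T' : Fin q → Σ W : Type u, ThreeGraph W}
    {M h n : ℕ} (hT' : OffDiagArrows T' M) (hfin : ∀ c, Finite (T' c).1)
    (hcard : ∀ c, Nat.card (T' c).1 ≤ h) (hM : 0 < M) (hn : 0 < n)
    (hT : ∀ c, BlowsUp T n c (T' c)) : OffDiagArrows T (M * (q * M ^ h * n)) := by
  intro X _ χ hX
  choose v hv using hT
  obtain ⟨c, φ, Y, hY, hψ⟩ := hT'.exists_large_fiber hfin hcard v hM hn X χ hX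
  exact hv c X χ φ Y hY hψ

theorem blowsUp_self {q : ℕ} (T : Fin q → Σ W : Type u, ThreeGraph W) {n : ℕ} (hn : 0 < n)
    (c : Fin q) (hne : Nonempty (T c).1) : BlowsUp T n c (T c) := by
  obtain ⟨v⟩ := hne
  refine ⟨v, fun X _ χ φ Y hY hψ => ?_⟩
  obtain ⟨y, hy⟩ := Finset.card_pos.1 (hn.trans_le hY)
  obtain ⟨ψ, -, -, h⟩ := hψ y hy
  exact ⟨c, ψ, h⟩

/-- The copy of `G[U]` found among the images of `none` replaces `none`. An edge inside `U` has the
right colour from that copy. Any other edge meets `U` at most once, so it lies in one of the given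
copies of the collapsed graph. -/
theorem blowsUp_collapse {q : ℕ} (T : Fin q → Σ W : Type u, ThreeGraph W) {n : ℕ} (hn : 0 < n)
    (c : Fin q) (U : Set (T c).1) (hU : ∀ e ∈ (T c).2.edges, ((e : Set (T c).1) ∩ U).ncard ≠ 2)
    (hF : OffDiagArrows (Function.update T c ⟨U, (T c).2.induce U⟩) n) :
    BlowsUp T n c ⟨_, (T c).2.collapse U⟩ := by
  classical
  refine ⟨none, fun X _ χ φ Y hY hψ => ?_⟩
  obtain ⟨c', hc'⟩ := hF {y // y ∈ Y} (fun s => χ (s.map (Function.Embedding.subtype _)))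
    (by simpa using hY)
  by_cases hcc : c' = c
  swap
  · rw [Function.update_of_ne hcc] at hc'
    obtain ⟨φ', h⟩ := hc'
    refine ⟨c', φ'.trans (Function.Embedding.subtype _), fun e he => ?_⟩
    rw [← Finset.map_map]
    exact h e he
  subst hcc
  rw [Function.update_self] at hc'
  obtain ⟨φF, hφF⟩ := hc'
  obtain ⟨y₀, hy₀⟩ := Finset.card_pos.1 (hn.trans_le hY)
  have hne : Nonempty ((⟨_, (T c').2.collapse U⟩ : Σ W : Type u, ThreeGraph W).1 ↪ X) :=
    ⟨(hψ y₀ hy₀).choose⟩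
  choose! ψ hψv hψw hψe using hψ
  let Φ : (T c').1 → X := fun v => if h : v ∈ U then φF ⟨v, h⟩ else φ (some ⟨v, h⟩)
  have hΦU : ∀ v (h : v ∈ U), Φ v = φF ⟨v, h⟩ := fun v h => dif_pos h
  have hΦU' : ∀ v (h : v ∉ U), ∀ y ∈ Y, Φ v = ψ y (some ⟨v, h⟩) := fun v h y hy => by
    rw [hψw y hy _ (by simp)]
    exact dif_neg h
  have hmixed : ∀ v v', v ∈ U → v' ∉ U → Φ v ≠ Φ v' := by
    intro v v' h h' heq
    rw [hΦU v h, hΦU' v' h' _ (φF ⟨v, h⟩).2] at heq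
    have h2 := (ψ _).injective ((hψv _ (φF ⟨v, h⟩).2).trans heq)
    simp at h2
  have hinj : Function.Injective Φ := by
    intro v v' heq
    by_cases h : v ∈ U <;> by_cases h' : v' ∈ U
    · rw [hΦU v h, hΦU v' h'] at heq
      exact congrArg Subtype.val (φF.injective (Subtype.ext heq))
    · exact absurd heq (hmixed v v' h h')
    · exact absurd heq.symm (hmixed v' v h' h)
    · rw [hΦU' v h y₀ hy₀, hΦU' v' h' y₀ hy₀] at heq
      simpa using (ψ y₀).injective heq
  refine ⟨c', ⟨Φ, hinj⟩, fun e he => ?_⟩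
  by_cases hsub : ∀ v ∈ e, v ∈ U
  · have h1 : (e.subtype (· ∈ U)).map (Function.Embedding.subtype _) = e :=
      Finset.subtype_map_of_mem hsub
    have h2 := hφF (e.subtype (· ∈ U)) (by
      change (e.subtype (· ∈ U)).map (Function.Embedding.subtype _) ∈ (T c').2.edges
      rw [h1]
      exact he)
    rw [Finset.map_map] at h2
    convert h2 using 2
    conv_lhs => rw [← h1]
    rw [Finset.map_map]
    ext x
    simp only [Finset.mem_map, Function.Embedding.trans_apply]
    refine exists_congr fun a => and_congr_right fun _ => ?_
    rw [show (⟨Φ, hinj⟩ : (T c').1 ↪ X) ((Function.Embedding.subtype _) a) = φF a from hΦU a a.2]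
    rfl
  · have hcard := (T c').2.card_edge e he
    have hle : ((e : Set (T c').1) ∩ U).ncard ≤ 1 := by
      have hlt : ((e : Set (T c').1) ∩ U).ncard < (e : Set (T c').1).ncard := by
        refine Set.ncard_lt_ncard ⟨Set.inter_subset_left, fun h => hsub fun v hv => (h hv).2⟩
          e.finite_toSet
      rw [Set.ncard_coe_finset, hcard] at hlt
      have := hU e he
      omega
    rw [Set.ncard_le_one (e.finite_toSet.inter_of_left _)] at hle
    -- The vertex of `e` in `U`, if there is one, selects the copy `ψ y`; otherwise any copy will
    -- do.
    obtain ⟨y, hy, hyU⟩ : ∃ y ∈ Y, ∀ v ∈ e, ∀ h : v ∈ U, (φF ⟨v, h⟩ : X) = y := by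
      by_cases hex : ∃ v ∈ e, v ∈ U
      · obtain ⟨u, hue, huU⟩ := hex
        refine ⟨φF ⟨u, huU⟩, (φF ⟨u, huU⟩).2, fun v hv h => ?_⟩
        have := hle v ⟨hv, h⟩ u ⟨hue, huU⟩
        subst this
        rfl
      · exact ⟨y₀, hy₀, fun v hv h => absurd ⟨v, hv, h⟩ hex⟩
    have hcol : ∀ v ∈ e, Φ v = ψ y (collapseMap U v) := by
      intro v hv
      by_cases h : v ∈ U
      · rw [hΦU v h, hyU v hv h, collapseMap, dif_pos h, hψv y hy]
      · rw [hΦU' v h y hy, collapseMap, dif_neg h]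
    have hinjC : Set.InjOn (collapseMap U) (e : Set (T c').1) := by
      intro v hv v' hv' heq
      exact hinj (by rw [hcol v hv, hcol v' hv', heq])
    have h3 := hψe y hy (e.image (collapseMap U))
      ⟨by rw [Finset.card_image_of_injOn hinjC, hcard], e, he, by simp⟩
    convert h3 using 2
    rw [Finset.map_eq_image, Finset.map_eq_image, Finset.image_image]
    exact Finset.image_congr hcol

/-! ### Ramsey bounds for pairs, triples and stars -/

/-- The usual neighbourhood argument: pass to the majority colour at a vertex and lower that
colour's target by one, so the sum of the targets drops. -/
theorem exists_monochromatic_clique {X : Type*} [DecidableEq X] {q : ℕ} (col : X → X → Fin q)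
    (hcol : ∀ x y, col x y = col y x) (n : ℕ) (t : Fin q → ℕ) (ht : ∑ c, t c ≤ n)
    (Y : Finset X) (hY : (q + 1) ^ n ≤ Y.card) :
    ∃ c, ∃ B ⊆ Y, B.card = t c ∧ ∀ x ∈ B, ∀ y ∈ B, x ≠ y → col x y = c := by
  induction n generalizing t Y with
  | zero =>
    obtain ⟨y, -⟩ := Finset.card_pos.1 (Nat.pos_of_ne_zero (by
      intro h; rw [h] at hY; simp at hY) : 0 < Y.card)
    refine ⟨col y y, ∅, by simp, ?_, by simp⟩
    have := Finset.single_le_sum (f := t) (fun _ _ => Nat.zero_le _) (Finset.mem_univ (col y y))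
    simp; omega
  | succ n ih =>
    obtain ⟨y, hy⟩ := Finset.card_pos.1 ((Nat.pow_pos (Nat.succ_pos q)).trans_le hY)
    obtain ⟨c, -, hc⟩ := Finset.exists_le_card_fiber_of_mul_le_card_of_maps_to
      (s := Y.erase y) (t := (Finset.univ : Finset (Fin q))) (f := col y) (n := (q + 1) ^ n)
      (fun _ _ => Finset.mem_univ _) ⟨col y y, Finset.mem_univ _⟩ (by
        rw [Finset.card_erase_of_mem hy, Finset.card_univ, Fintype.card_fin]
        have h1 : (q + 1) ^ (n + 1) = q * (q + 1) ^ n + (q + 1) ^ n := by ring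
        have h2 : 0 < (q + 1) ^ n := Nat.pow_pos (Nat.succ_pos q)
        omega)
    set Y' := (Y.erase y).filter fun x => col y x = c with hY'
    have hsub : Y' ⊆ Y := (Finset.filter_subset _ _).trans (Finset.erase_subset _ _)
    -- A zero target is met by the empty set; this case is split off since `t c - 1` would not
    -- decrease.
    by_cases h0 : t c = 0
    · exact ⟨c, ∅, by simp, by simp [h0], by simp⟩
    have hsum : ∑ c', Function.update t c (t c - 1) c' ≤ n := by
      have h1 := Finset.sum_update_of_mem (Finset.mem_univ c) t (t c - 1)
      have h2 := Finset.add_sum_erase Finset.univ t (Finset.mem_univ c)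
      rw [Finset.sdiff_singleton_eq_erase] at h1
      omega
    obtain ⟨c', B, hB, hBc, hBcol⟩ := ih (Function.update t c (t c - 1)) hsum Y' hc
    by_cases hcc : c' = c
    · subst hcc
      rw [Function.update_self] at hBc
      have hyB : y ∉ B := fun h => by simpa [hY'] using hB h
      have hyx : ∀ x ∈ B, col y x = c' := fun x hx => (Finset.mem_filter.1 (hB hx)).2
      refine ⟨c', insert y B, Finset.insert_subset hy (hB.trans hsub), ?_, ?_⟩
      · rw [Finset.card_insert_of_notMem hyB]; omega
      · intro a ha b hb hab
        rcases Finset.mem_insert.1 ha with ha' | ha' <;> rcases Finset.mem_insert.1 hb with hb' | hb'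
        · exact absurd (ha'.trans hb'.symm) hab
        · rw [ha']; exact hyx b hb'
        · rw [hb', hcol]; exact hyx a ha'
        · exact hBcol a ha' b hb' hab
    · rw [Function.update_of_ne hcc] at hBc
      exact ⟨c', B, hB.trans hsub, hBc, hBcol⟩

/-- In a large set there is a long sequence of vertices such that the color of a triple of its
members, listed in increasing order, depends only on the first two of them. -/
theorem exists_end_homogeneous {X : Type*} [DecidableEq X] {q : ℕ} (χ : Finset X → Fin q)
    (m k : ℕ) (Y₀ : Finset X) (hX : (q + 1) ^ (m * m + k) ≤ Y₀.card) :
    ∃ (v : ℕ → X) (col : ℕ → ℕ → Fin q) (Y : Finset X), (q + 1) ^ k ≤ Y.card ∧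
      (∀ i < m, v i ∉ Y) ∧ (∀ i j, i < j → j < m → v i ≠ v j) ∧
      (∀ i j, i < j → j < m → ∀ y ∈ Y, χ {v i, v j, y} = col i j) ∧
      ∀ i j l, i < j → j < l → l < m → χ {v i, v j, v l} = col i j := by
  induction m generalizing k with
  | zero =>
    obtain ⟨y, -⟩ := Finset.card_pos.1 ((Nat.pow_pos (Nat.succ_pos q)).trans_le hX)
    exact ⟨fun _ => y, fun _ _ => χ ∅, Y₀, by simpa using hX, by simp, by simp, by simp, by simp⟩
  | succ m ih =>
    -- The reserve `2 * m + 1` is `(m + 1)² - m²`. It pays for removing the new vertex `y` and for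
    -- the `q ^ m` classes of the remaining points by their colours with `y` and each earlier
    -- vertex.
    obtain ⟨v, col, Y, hY, hvY, hv, hcolY, hcol⟩ := ih (2 * m + 1 + k) (by
      rwa [show m * m + (2 * m + 1 + k) = (m + 1) * (m + 1) + k by ring])
    obtain ⟨y, hy⟩ := Finset.card_pos.1 ((Nat.pow_pos (Nat.succ_pos q)).trans_le hY)
    obtain ⟨f, -, hf⟩ := Finset.exists_le_card_fiber_of_mul_le_card_of_maps_to
      (s := Y.erase y) (t := (Finset.univ : Finset (Fin m → Fin q)))
      (f := fun x i => χ {v i, y, x}) (n := (q + 1) ^ k)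
      (fun _ _ => Finset.mem_univ _) ⟨fun _ => χ ∅, Finset.mem_univ _⟩ (by
        rw [Finset.card_erase_of_mem hy, Finset.card_univ, Fintype.card_fun, Fintype.card_fin,
          Fintype.card_fin]
        have h1 : q ^ m ≤ (q + 1) ^ m := Nat.pow_le_pow_left (Nat.le_succ q) m
        have h2 : 0 < (q + 1) ^ k := Nat.pow_pos (Nat.succ_pos q)
        have h3 : 0 < (q + 1) ^ m := Nat.pow_pos (Nat.succ_pos q)
        have hq : 0 < q := (χ ∅).pos
        have h4 : q ^ m * (q + 1) ^ k + 1 ≤ (q + 1) ^ (2 * m + 1 + k) := by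
          calc q ^ m * (q + 1) ^ k + 1 ≤ (q + 1) ^ m * (q + 1) ^ k + (q + 1) ^ m * (q + 1) ^ k :=
                Nat.add_le_add (Nat.mul_le_mul_right _ h1) (Nat.mul_pos h3 h2)
            _ = 2 * 1 * ((q + 1) ^ m * (q + 1) ^ k) := by ring
            _ ≤ (q + 1) * (q + 1) ^ m * ((q + 1) ^ m * (q + 1) ^ k) :=
                Nat.mul_le_mul_right _ (Nat.mul_le_mul (by omega) h3)
            _ = (q + 1) ^ (2 * m + 1 + k) := by ring
        omega)
    set Y' := (Y.erase y).filter fun x => (fun i : Fin m => χ {v i, y, x}) = f with hY'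
    have hsub : ∀ x ∈ Y', x ∈ Y := fun x hx =>
      Finset.mem_of_mem_erase (Finset.mem_of_mem_filter x hx)
    have hyY' : y ∉ Y' := fun h => by simp [hY'] at h
    have hvy : ∀ i < m, v i ≠ y := fun i hi h => hvY i hi (h ▸ hy)
    have hw : ∀ i < m, Function.update v m y i = v i := fun i hi => Function.update_of_ne hi.ne _ _
    have hwm : Function.update v m y m = y := Function.update_self _ _ _
    obtain ⟨col', hc1, hc2⟩ : ∃ col' : ℕ → ℕ → Fin q, (∀ i j, j < m → col' i j = col i j) ∧
        ∀ i (hi : i < m), col' i m = f ⟨i, hi⟩ :=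
      ⟨fun i j => if j = m then (if hi : i < m then f ⟨i, hi⟩ else χ ∅) else col i j,
        fun i j hj => by simp [hj.ne], fun i hi => by simp [hi]⟩
    refine ⟨Function.update v m y, col', Y', hf, ?_, ?_, ?_, ?_⟩
    · intro i hi
      rcases (Nat.lt_succ_iff_lt_or_eq.1 hi) with hi | rfl
      · rw [hw i hi]; exact fun h => hvY i hi (hsub _ h)
      · rwa [hwm]
    · intro i j hij hj
      rcases (Nat.lt_succ_iff_lt_or_eq.1 hj) with hj | rfl
      · rw [hw i (hij.trans hj), hw j hj]; exact hv i j hij hj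
      · rw [hw i hij, hwm]; exact hvy i hij
    · intro i j hij hj x hx
      rcases (Nat.lt_succ_iff_lt_or_eq.1 hj) with hj | rfl
      · rw [hw i (hij.trans hj), hw j hj, hc1 i j hj]; exact hcolY i j hij hj x (hsub x hx)
      · rw [hw i hij, hwm, hc2 i hij]
        exact congrFun (Finset.mem_filter.1 hx).2 ⟨i, hij⟩
    · intro i j l hij hjl hl
      rcases (Nat.lt_succ_iff_lt_or_eq.1 hl) with hl | rfl
      · rw [hw i (hij.trans (hjl.trans hl)), hw j (hjl.trans hl), hw l hl, hc1 i j (hjl.trans hl)]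
        exact hcol i j l hij hjl hl
      · rw [hw i (hij.trans hjl), hw j hjl, hwm, hc1 i j hjl]
        exact hcolY i j hij hjl y hy

/-- Erdős–Rado: on an end-homogeneous sequence the triple colouring becomes a pair colouring of the
indices, to which the clique bound applies. -/
theorem exists_monochromatic_triples {X : Type*} [DecidableEq X] {q : ℕ} (χ : Finset X → Fin q)
    (t : ℕ) (Y : Finset X) (hY : (q + 1) ^ ((q + 1) ^ (q * t) * (q + 1) ^ (q * t)) ≤ Y.card) :
    ∃ c, ∃ B : Finset X, B.card = t ∧ ∀ e ⊆ B, e.card = 3 → χ e = c := by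
  set m := (q + 1) ^ (q * t) with hm
  obtain ⟨v, col, -, -, -, hv, -, hcol⟩ := exists_end_homogeneous χ m 0 Y hY
  obtain ⟨c, B, hBm, hBt, hB⟩ := exists_monochromatic_clique
    (fun i j => col (min i j) (max i j)) (fun i j => by rw [min_comm, max_comm]) (q * t)
    (fun _ => t) (by simp) (Finset.range m) (by simp [hm])
  have hinj : Set.InjOn v (B : Set ℕ) := by
    intro i hi j hj hij
    have hi' := Finset.mem_range.1 (hBm hi)
    have hj' := Finset.mem_range.1 (hBm hj)
    rcases lt_trichotomy i j with h | h | h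
    · exact absurd hij (hv i j h hj')
    · exact h
    · exact absurd hij.symm (hv j i h hi')
  refine ⟨c, B.image v, by rw [Finset.card_image_of_injOn hinj, hBt], fun e he he3 => ?_⟩
  obtain ⟨e', he'B, rfl⟩ := Finset.subset_image_iff.1 he
  rw [Finset.card_image_of_injOn (hinj.mono he'B)] at he3
  have key : ∃ i j l, i < j ∧ j < l ∧ e' = {i, j, l} := by
    set g := e'.orderEmbOfFin he3 with hg
    refine ⟨g 0, g 1, g 2, g.strictMono (by decide), g.strictMono (by decide), ?_⟩
    have := Finset.image_orderEmbOfFin_univ e' he3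
    rw [← hg, show (Finset.univ : Finset (Fin 3)) = {0, 1, 2} from rfl] at this
    simpa using this.symm
  obtain ⟨i, j, l, hij, hjl, rfl⟩ := key
  have hl := Finset.mem_range.1 (hBm (he'B (by simp : l ∈ ({i, j, l} : Finset ℕ))))
  rw [Finset.image_insert, Finset.image_insert, Finset.image_singleton, hcol i j l hij hjl hl]
  have := hB i (he'B (by simp)) j (he'B (by simp)) hij.ne
  rwa [min_eq_left hij.le, max_eq_right hij.le] at this

theorem offDiagArrows_all {q : ℕ} (T : Fin q → Σ W : Type u, ThreeGraph W)
    (hfin : ∀ c, Finite (T c).1) (t : ℕ) (ht : ∀ c, Nat.card (T c).1 ≤ t) :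
    OffDiagArrows T ((q + 1) ^ ((q + 1) ^ (q * t) * (q + 1) ^ (q * t))) := by
  classical
  intro X _ χ hX
  obtain ⟨c, B, hB, hc⟩ := exists_monochromatic_triples χ t Finset.univ hX
  have := Fintype.ofFinite (T c).1
  obtain ⟨φ⟩ : Nonempty ((T c).1 ↪ B) := Function.Embedding.nonempty_of_card_le (by
    rw [Fintype.card_coe, hB, ← Nat.card_eq_fintype_card]; exact ht c)
  refine ⟨c, φ.trans (Function.Embedding.subtype _), fun e he => hc _ ?_ ?_⟩
  · intro x hx
    obtain ⟨w, -, rfl⟩ := Finset.mem_map.1 hx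
    exact (φ w).2
  · rw [Finset.card_map]
    exact (T c).2.card_edge e he

/-- Graphs in which some vertex lies on all edges. -/
theorem offDiagArrows_star {q : ℕ} (T : Fin q → Σ W : Type u, ThreeGraph W)
    (hfin : ∀ c, Finite (T c).1) (t : ℕ) (ht : ∀ c, Nat.card (T c).1 ≤ t)
    (v : ∀ c, (T c).1) (hv : ∀ c, ∀ e ∈ (T c).2.edges, v c ∈ e) :
    OffDiagArrows T ((q + 1) ^ (q * t) + 1) := by
  classical
  intro X _ χ hX
  -- The common vertex goes to `a` and the remaining vertices to a monochromatic clique in the link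
  -- of `a`.
  obtain ⟨a⟩ : Nonempty X := Fintype.card_pos_iff.1 (by omega)
  obtain ⟨c, B, hBa, hBt, hB⟩ := exists_monochromatic_clique
    (fun x y => χ {a, x, y}) (fun x y => by rw [Finset.pair_comm]) (q * t)
    (fun _ => t) (by simp) (Finset.univ.erase a) (by
      rw [Finset.card_erase_of_mem (Finset.mem_univ a), Finset.card_univ]; omega)
  have := Fintype.ofFinite (T c).1
  obtain ⟨φ⟩ : Nonempty ((T c).1 ↪ B) := Function.Embedding.nonempty_of_card_le (by
    rw [Fintype.card_coe, hBt, ← Nat.card_eq_fintype_card]; exact ht c)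
  have hBa' : ∀ b : B, (b : X) ≠ a := fun b => Finset.ne_of_mem_erase (hBa b.2)
  let Φ : (T c).1 → X := fun w => if w = v c then a else φ w
  have hΦ : ∀ w, w ≠ v c → Φ w = φ w := fun w hw => if_neg hw
  have hΦv : Φ (v c) = a := if_pos rfl
  have hinj : Function.Injective Φ := by
    intro w w' h
    by_cases h1 : w = v c <;> by_cases h2 : w' = v c
    · rw [h1, h2]
    · rw [h1, hΦv, hΦ w' h2] at h; exact absurd h.symm (hBa' _)
    · rw [h2, hΦv, hΦ w h1] at h; exact absurd h (hBa' _)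
    · rw [hΦ w h1, hΦ w' h2] at h; exact φ.injective (Subtype.ext h)
  refine ⟨c, ⟨Φ, hinj⟩, fun e he => ?_⟩
  have hcard := (T c).2.card_edge e he
  have he2 : (e.erase (v c)).card = 2 := by
    rw [Finset.card_erase_of_mem (hv c e he), hcard]
  obtain ⟨x, y, hxy, hexy⟩ := Finset.card_eq_two.1 he2
  have hx : x ≠ v c := Finset.ne_of_mem_erase (hexy ▸ (by simp) : x ∈ e.erase (v c))
  have hy : y ≠ v c := Finset.ne_of_mem_erase (hexy ▸ (by simp) : y ∈ e.erase (v c))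
  rw [← Finset.insert_erase (hv c e he), hexy, Finset.map_insert, Finset.map_insert,
    Finset.map_singleton]
  change χ {Φ (v c), Φ x, Φ y} = c
  rw [hΦv, hΦ x hx, hΦ y hy]
  exact hB _ (φ x).2 _ (φ y).2 fun h => hxy (φ.injective (Subtype.ext h))

/-! ### Tripartite graphs and exact transversals -/

theorem offDiagArrows_of_edgeless {q : ℕ} (T : Fin q → Σ W : Type u, ThreeGraph W) (c : Fin q)
    (F : Σ W : Type u, ThreeGraph W) (hc : T c = F) (hF : F.2.edges = ∅) (hfin : Finite F.1)
    {N : ℕ} (hN : Nat.card F.1 ≤ N) : OffDiagArrows T N := by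
  subst hc
  intro X _ χ hX
  have := Fintype.ofFinite (T c).1
  obtain ⟨φ⟩ : Nonempty ((T c).1 ↪ X) := Function.Embedding.nonempty_of_card_le (by
    rw [← Nat.card_eq_fintype_card]; exact hN.trans hX)
  exact ⟨c, φ, fun e he => by simp [hF] at he⟩

theorem card_collapse_le {W : Type u} [Finite W] (U : Set W) :
    Nat.card (Option {v : W // v ∉ U}) ≤ Nat.card W + 1 := by
  rw [Finite.card_option]
  exact Nat.succ_le_succ (Finite.card_subtype_le _)

theorem ncard_inter_le_one {W : Type u} {e : Finset W} {p : W → Fin 3}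
    (hp : Set.InjOn p (e : Set W)) (i : Fin 3) : ((e : Set W) ∩ {w | p w = i}).ncard ≤ 1 := by
  rw [Set.ncard_le_one (e.finite_toSet.inter_of_left _)]
  exact fun a ha b hb => hp ha.1 hb.1 (ha.2.trans hb.2.symm)

theorem induce_edges_eq_empty {W : Type u} (G : ThreeGraph W) (U : Set W)
    (hU : ∀ e ∈ G.edges, ((e : Set W) ∩ U).ncard ≤ 1) : (G.induce U).edges = ∅ := by
  refine Set.eq_empty_of_forall_notMem fun e he => ?_
  have h1 := hU _ he
  have h3 := G.card_edge _ he
  rw [Set.inter_eq_left.2, Set.ncard_coe_finset, h3] at h1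
  · omega
  · intro x hx
    obtain ⟨y, -, rfl⟩ := Finset.mem_map.1 (Finset.mem_coe.1 hx)
    exact y.2

/-- Collapsing a set that no edge meets twice, simultaneously in all colors. -/
theorem OffDiagArrows.of_collapse_sparse {q : ℕ} (T : Fin q → Σ W : Type u, ThreeGraph W) (t : ℕ)
    (hq : 2 ≤ q) (hfin : ∀ c, Finite (T c).1) (ht : ∀ c, Nat.card (T c).1 ≤ t)
    (U : ∀ c, Set (T c).1)
    (hU : ∀ c, ∀ e ∈ (T c).2.edges, ((e : Set (T c).1) ∩ U c).ncard ≤ 1) {a : ℕ}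
    (h : OffDiagArrows (fun c => ⟨_, (T c).2.collapse (U c)⟩) (q ^ a)) :
    OffDiagArrows T (q ^ (a * (t + 2) + t + 1)) := by
  have hq0 : 0 < q := by omega
  -- Each `G[U]` is edgeless, so the fibre only needs room for at most `t` vertices, and `t < q ^
  -- t`.
  have h1 := OffDiagArrows.of_blowsUp (T := T) (n := q ^ t) (h := t + 1) h
    (fun c => by have := hfin c; dsimp only; infer_instance)
    (fun c => by have := hfin c; exact (card_collapse_le _).trans (Nat.succ_le_succ (ht c)))
    (Nat.pow_pos hq0) (Nat.pow_pos hq0)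
    (fun c => blowsUp_collapse T (Nat.pow_pos hq0) c (U c)
      (fun e he => by have := hU c e he; omega)
      (offDiagArrows_of_edgeless _ c _ (Function.update_self ..)
        (induce_edges_eq_empty _ _ (hU c)) (by have := hfin c; dsimp only; infer_instance) (by
          have := hfin c
          have hle : Nat.card (U c) ≤ t := (Finite.card_subtype_le _).trans (ht c)
          exact hle.trans (t.lt_pow_self hq).le)))
  refine h1.mono (le_of_eq ?_)
  ring

/-- The parts are shrunk to points one at a time; `k` bounds how many may still be large. An edge
meets a part at most once, so each collapse is sparse and keeps the bound polynomial in `q`. -/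
theorem offDiagArrows_tripartite (k : ℕ) (hk : k ≤ 3) (t : ℕ) :
    ∃ C, ∀ q, 2 ≤ q → ∀ T : Fin q → Σ W : Type u, ThreeGraph W,
      (∀ c, Finite (T c).1) → (∀ c, Nat.card (T c).1 ≤ t) → ∀ p : ∀ c, (T c).1 → Fin 3,
      (∀ c, ∀ e ∈ (T c).2.edges, Set.InjOn (p c) (e : Set (T c).1)) →
      (∀ c (i : Fin 3), k ≤ i → ∀ w w', p c w = i → p c w' = i → w = w') →
      OffDiagArrows T (q ^ C) := by
  induction k generalizing t with
  | zero =>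
    -- Now each target has at most three vertices, so any single triple serves the target of its own
    -- colour; `q ^ 2 ≥ 4` leaves room for one.
    refine ⟨2, fun q hq T hfin ht p hp hinj X _ χ hX => ?_⟩
    obtain ⟨ι⟩ : Nonempty (Fin 3 ↪ X) := Function.Embedding.nonempty_of_card_le (by
      rw [Fintype.card_fin]; nlinarith)
    refine ⟨χ (Finset.univ.map ι), (⟨p _, fun w w' h => hinj _ (p _ w) (Nat.zero_le _) w w' rfl
      h.symm⟩ : _ ↪ Fin 3).trans ι, fun e he => ?_⟩
    rw [← Finset.map_map]
    congr 2
    rw [← Finset.card_eq_iff_eq_univ, Finset.card_map, (T _).2.card_edge e he, Fintype.card_fin]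
  | succ k ih =>
    obtain ⟨C, hC⟩ := ih (by omega) (t + 1)
    refine ⟨C * (t + 2) + t + 1, fun q hq T hfin ht p hp hinj => ?_⟩
    set i₀ : Fin 3 := ⟨k, by omega⟩ with hi₀
    set U : ∀ c, Set (T c).1 := fun c => {w | p c w = i₀} with hUdef
    refine OffDiagArrows.of_collapse_sparse T t hq hfin ht U
      (fun c e he => ncard_inter_le_one (hp c e he) i₀) ?_
    have hpc : ∀ c w, (collapseMap (U c) w).elim i₀ (fun v => p c v) = p c w := by
      intro c w
      by_cases h : w ∈ U c
      · rw [collapseMap, dif_pos h]; exact Eq.symm h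
      · rw [collapseMap, dif_neg h]; rfl
    refine hC q hq _ (fun c => by have := hfin c; dsimp only; infer_instance)
      (fun c => by have := hfin c; exact (card_collapse_le _).trans (Nat.succ_le_succ (ht c)))
      (fun c w => w.elim i₀ fun v => p c v) ?_ ?_
    · rintro c e ⟨-, f, hf, hef⟩
      dsimp only
      rw [hef]
      rintro _ ⟨a, ha, rfl⟩ _ ⟨b, hb, rfl⟩ hab
      dsimp only at hab
      rw [hpc, hpc] at hab
      rw [hp c f hf ha hb hab]
    · rintro c i hi (_ | ⟨w, hw⟩) (_ | ⟨w', hw'⟩) h h'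
      · rfl
      · exact absurd (h'.trans h.symm) hw'
      · exact absurd (h.trans h'.symm) hw
      · have hik : i ≠ i₀ := fun hik => hw (h.trans hik)
        have : k + 1 ≤ (i : ℕ) := by
          have := Fin.val_ne_of_ne hik
          simp only [hi₀] at this
          omega
        have := hinj c i this w w' h h'
        subst this
        rfl

/-- Collapsing the transversal is sparse, and it puts the new vertex on every edge, so the star
bound applies to the collapsed family. -/
theorem offDiagArrows_exactTransversal (t : ℕ) :
    ∃ C, ∀ q, 2 ≤ q → ∀ T : Fin q → Σ W : Type u, ThreeGraph W,
      (∀ c, Finite (T c).1) → (∀ c, Nat.card (T c).1 ≤ t) →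
      (∀ c, (T c).2.HasExactTransversal) → OffDiagArrows T (q ^ (C * q)) := by
  refine ⟨(2 * (t + 1) + 1) * (t + 2) + t + 1, fun q hq T hfin ht hS => ?_⟩
  choose S hS using hS
  have hstar : OffDiagArrows (fun c => ⟨_, (T c).2.collapse (S c)⟩)
      ((q + 1) ^ (q * (t + 1)) + 1) := by
    refine offDiagArrows_star _ (fun c => by have := hfin c; dsimp only; infer_instance) (t + 1)
      (fun c => by have := hfin c; exact (card_collapse_le _).trans (Nat.succ_le_succ (ht c)))
      (fun c => none) ?_
    rintro c e ⟨-, f, hf, hef⟩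
    obtain ⟨a, ha⟩ := Set.ncard_eq_one.1 (hS c f hf)
    have haf : a ∈ (f : Set (T c).1) ∩ S c := by rw [ha]; rfl
    rw [← Finset.mem_coe, hef]
    exact ⟨a, haf.1, dif_pos haf.2⟩
  have hle : (q + 1) ^ (q * (t + 1)) + 1 ≤ q ^ ((2 * (t + 1) + 1) * q) := by
    have h1 : q + 1 ≤ q ^ 2 := by nlinarith
    calc (q + 1) ^ (q * (t + 1)) + 1 ≤ (q ^ 2) ^ (q * (t + 1)) + (q ^ 2) ^ (q * (t + 1)) :=
          Nat.add_le_add (Nat.pow_le_pow_left h1 _) (Nat.pow_pos (by positivity))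
      _ = 2 * (q ^ 2) ^ (q * (t + 1)) := by ring
      _ ≤ q ^ q * (q ^ 2) ^ (q * (t + 1)) :=
          Nat.mul_le_mul_right _ (hq.trans (Nat.le_self_pow (by omega) q))
      _ = q ^ ((2 * (t + 1) + 1) * q) := by ring
  refine (OffDiagArrows.of_collapse_sparse T t hq hfin ht S (fun c e he => (hS c e he).le)
    (hstar.mono hle)).mono (Nat.pow_le_pow_right (by omega) ?_)
  nlinarith [Nat.zero_le t]

/-! ### Reduction chains and the upper bound for `𝒰_ℓ` -/

/-- `G` arises in at most `n` successive reductions, with all collapsed graphs and the terminal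
graph in `𝓗`. -/
def ReductionChain (𝓗 : Set (Σ W : Type u, ThreeGraph W)) :
    ℕ → (Σ W : Type u, ThreeGraph W) → Prop
  | 0 => fun G => G ∈ 𝓗
  | n + 1 => fun G => G ∈ 𝓗 ∨ ∃ U : Set G.1, G.2.IsCollapsible U ∧
      (⟨_, G.2.collapse U⟩ : Σ W : Type u, ThreeGraph W) ∈ 𝓗 ∧
      ReductionChain 𝓗 n ⟨_, G.2.induce U⟩

theorem ReductionChain.mono {𝓗 𝓗' : Set (Σ W : Type u, ThreeGraph W)} (h : 𝓗 ⊆ 𝓗') {n n' : ℕ}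
    (hn : n ≤ n') {G : Σ W : Type u, ThreeGraph W} (hG : ReductionChain 𝓗 n G) :
    ReductionChain 𝓗' n' G := by
  induction n generalizing n' G with
  | zero =>
    cases n' with
    | zero => exact h hG
    | succ n' => exact Or.inl (h hG)
  | succ n ih =>
    obtain ⟨n', rfl⟩ : ∃ m, n' = m + 1 := ⟨n' - 1, by omega⟩
    rcases hG with hG | ⟨U, hU, hH, hF⟩
    · exact Or.inl (h hG)
    · exact Or.inr ⟨U, hU, h hH, ih (by omega) hF⟩

theorem IsCollapsible.nonempty {W : Type u} {G : ThreeGraph W} {U : Set W}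
    (h : G.IsCollapsible U) : Nonempty U := by
  by_contra hne
  rw [Set.nonempty_coe_sort, Set.not_nonempty_iff_eq_empty] at hne
  have := h.1
  simp [hne] at this

theorem RedClosure.exists_reductionChain {P : ∀ W : Type u, ThreeGraph W → Prop} {W : Type u}
    {G : ThreeGraph W} (h : RedClosure P W G) [Finite W] [Nonempty W] :
    ∃ (n : ℕ) (𝓗 : Set (Σ W : Type u, ThreeGraph W)), 𝓗.Finite ∧
      (∀ H ∈ 𝓗, Finite H.1 ∧ Nonempty H.1 ∧ P H.1 H.2) ∧ ReductionChain 𝓗 n ⟨W, G⟩ := by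
  rename_i i1 i2
  revert i1 i2
  induction h with
  | base W G h =>
    intro _ _
    refine ⟨0, {⟨W, G⟩}, Set.finite_singleton _, ?_, Set.mem_singleton_iff.2 rfl⟩
    rintro _ rfl
    exact ⟨‹_›, ‹_›, h⟩
  | reduce W G U hU hH hF ih =>
    intro _ _
    have := hU.nonempty
    obtain ⟨n, 𝓗, hfin, hP, hc⟩ := ih
    refine ⟨n + 1, insert ⟨_, G.collapse U⟩ 𝓗, hfin.insert _, ?_, ?_⟩
    · rintro H (rfl | hH')
      · exact ⟨by dsimp only; infer_instance, ⟨none⟩, hH⟩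
      · exact hP H hH'
    · exact Or.inr ⟨U, hU, Set.mem_insert _ _, hc.mono (Set.subset_insert _ _) le_rfl⟩

/-- Induction on the total remaining depth over all colours. In each round every colour offers
either its target or that target's collapse, all in `𝓗`. The fibre found belongs to one colour, and
only that colour's depth falls. -/
theorem offDiagArrows_of_reductionChain {𝓗 : Set (Σ W : Type u, ThreeGraph W)} {q M h : ℕ}
    (hq : 0 < q) (hM : 0 < M) (hfin : ∀ H ∈ 𝓗, Finite H.1) (hne : ∀ H ∈ 𝓗, Nonempty H.1)
    (hcard : ∀ H ∈ 𝓗, Nat.card H.1 ≤ h)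
    (hH : ∀ T : Fin q → Σ W : Type u, ThreeGraph W, (∀ c, T c ∈ 𝓗) → OffDiagArrows T M) (n : ℕ)
    (d : Fin q → ℕ) (hd : ∑ c, d c ≤ n) (T : Fin q → Σ W : Type u, ThreeGraph W)
    (hT : ∀ c, ReductionChain 𝓗 (d c) (T c)) : OffDiagArrows T ((M * (q * M ^ h)) ^ (n + 1)) := by
  induction n generalizing d T with
  | zero =>
    have hd0 : ∀ c, d c = 0 := fun c => by
      have := Finset.single_le_sum (f := d) (fun _ _ => Nat.zero_le _) (Finset.mem_univ c)
      omega
    refine (hH T fun c => ?_).mono ?_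
    · have := hT c
      rw [hd0 c] at this
      exact this
    · rw [zero_add, pow_one]
      exact Nat.le_mul_of_pos_right _ (by positivity)
  | succ n ih =>
    set K := M * (q * M ^ h) with hK
    have hK0 : 0 < K := by positivity
    have hstep : ∀ c, ∃ H ∈ 𝓗, BlowsUp T (K ^ (n + 1)) c H := by
      intro c
      have hc := hT c
      rcases hdc : d c with _ | m
      · rw [hdc] at hc
        exact ⟨T c, hc, blowsUp_self T (Nat.pow_pos hK0) c (hne _ hc)⟩
      · rw [hdc] at hc
        rcases hc with hc | ⟨U, hU, hcH, hF⟩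
        · exact ⟨T c, hc, blowsUp_self T (Nat.pow_pos hK0) c (hne _ hc)⟩
        · refine ⟨_, hcH, blowsUp_collapse T (Nat.pow_pos hK0) c U hU.2.2 ?_⟩
          -- Colour `c` now seeks `G[U]`, with depth `m` instead of `m + 1`; all other targets are
          -- unchanged.
          refine ih (Function.update d c m) ?_ _ ?_
          · have h1 := Finset.sum_update_of_mem (Finset.mem_univ c) d m
            have h2 := Finset.add_sum_erase Finset.univ d (Finset.mem_univ c)
            rw [Finset.sdiff_singleton_eq_erase] at h1
            omega
          · intro c'
            by_cases hcc : c' = c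
            · subst hcc
              rw [Function.update_self, Function.update_self]
              exact hF
            · rw [Function.update_of_ne hcc, Function.update_of_ne hcc]
              exact hT c'
    choose T' hT' hB using hstep
    refine ((hH T' hT').of_blowsUp (fun c => hfin _ (hT' c)) (fun c => hcard _ (hT' c)) hM
      (Nat.pow_pos hK0) hB).mono (le_of_eq ?_)
    rw [pow_succ K (n + 1)]
    simp only [hK]
    ring

theorem exists_card_bound {𝒢 : Set (Σ W : Type u, ThreeGraph W)} (h𝒢 : 𝒢.Finite) :
    ∃ t, ∀ G ∈ 𝒢, Nat.card G.1 ≤ t := by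
  obtain ⟨t, ht⟩ := (h𝒢.image fun G => Nat.card G.1).bddAbove
  exact ⟨t, fun G hG => ht ⟨G, hG, rfl⟩⟩

/-- The constant is uniform over all assignments of members of `𝒢` to colours. This is what the
recursion needs: the graphs collapsed in the various colours differ, but range over a finite family
one level down. -/
theorem offDiagArrows_uLevel (ℓ : ℕ) (𝒢 : Set (Σ W : Type u, ThreeGraph W)) (h𝒢 : 𝒢.Finite)
    (hU : ∀ G ∈ 𝒢, Finite G.1 ∧ Nonempty G.1 ∧ ULevel ℓ G.1 G.2) :
    ∃ C, ∀ q, 2 ≤ q → ∀ T : Fin q → Σ W : Type u, ThreeGraph W, (∀ c, T c ∈ 𝒢) →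
      OffDiagArrows T (q ^ (C * q ^ ℓ)) := by
  match ℓ with
  | 0 =>
    obtain ⟨t, ht⟩ := exists_card_bound h𝒢
    obtain ⟨C, hC⟩ := offDiagArrows_tripartite 3 le_rfl t
    refine ⟨C, fun q hq T hT => ?_⟩
    have hp : ∀ c, (T c).2.IsTripartite := fun c => (hU _ (hT c)).2.2
    choose p hp using hp
    rw [pow_zero, mul_one]
    exact hC q hq T (fun c => (hU _ (hT c)).1) (fun c => ht _ (hT c)) p hp
      fun c i hi => absurd i.2 (by omega)
  | 1 =>
    obtain ⟨t, ht⟩ := exists_card_bound h𝒢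
    obtain ⟨C, hC⟩ := offDiagArrows_exactTransversal t
    refine ⟨C, fun q hq T hT => ?_⟩
    rw [pow_one]
    exact hC q hq T (fun c => (hU _ (hT c)).1) (fun c => ht _ (hT c))
      fun c => (hU _ (hT c)).2.2
  | ℓ + 2 =>
    have hchain : ∀ G : 𝒢, ∃ (n : ℕ) (𝓗 : Set (Σ W : Type u, ThreeGraph W)), 𝓗.Finite ∧
        (∀ H ∈ 𝓗, Finite H.1 ∧ Nonempty H.1 ∧ ULevel (ℓ + 1) H.1 H.2) ∧
        ReductionChain 𝓗 n G.1 := by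
      rintro ⟨G, hG⟩
      obtain ⟨h1, h2, h3⟩ := hU G hG
      exact RedClosure.exists_reductionChain h3
    choose n 𝓗 hfin hP hc using hchain
    have := h𝒢.to_subtype
    obtain ⟨D, hD⟩ := (Set.finite_range n).bddAbove
    set 𝓗' := ⋃ G, 𝓗 G with h𝓗'
    have hfin' : 𝓗'.Finite := Set.finite_iUnion hfin
    have hP' : ∀ H ∈ 𝓗', Finite H.1 ∧ Nonempty H.1 ∧ ULevel (ℓ + 1) H.1 H.2 := by
      intro H hH
      obtain ⟨G, hG⟩ := Set.mem_iUnion.1 hH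
      exact hP G H hG
    obtain ⟨h, hh⟩ := exists_card_bound hfin'
    obtain ⟨C, hC⟩ := offDiagArrows_uLevel (ℓ + 1) 𝓗' hfin' hP'
    refine ⟨(C * (h + 1) + 1) * (D + 1), fun q hq T hT => ?_⟩
    have hq0 : 0 < q := by omega
    -- The total depth `D * q` is the source of the extra factor `q` in the exponent.
    refine (offDiagArrows_of_reductionChain hq0 (Nat.pow_pos hq0) (fun H hH => (hP' H hH).1)
      (fun H hH => (hP' H hH).2.1) hh (hC q hq) (D * q) (fun _ => D) (by simp [mul_comm]) T
      fun c => (hc ⟨T c, hT c⟩).mono (Set.subset_iUnion _ _) (hD ⟨_, rfl⟩)).mono ?_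
    have h1 : q ^ (C * q ^ (ℓ + 1)) * (q * (q ^ (C * q ^ (ℓ + 1))) ^ h) =
        q ^ (C * q ^ (ℓ + 1) * (h + 1) + 1) := by ring
    rw [h1, ← pow_mul]
    refine Nat.pow_le_pow_right hq0 ?_
    have h2 : 1 ≤ q ^ (ℓ + 1) := Nat.pow_pos hq0
    calc (C * q ^ (ℓ + 1) * (h + 1) + 1) * (D * q + 1)
        ≤ (C * q ^ (ℓ + 1) * (h + 1) + q ^ (ℓ + 1)) * (D * q + q) :=
          Nat.mul_le_mul (by omega) (by omega)
      _ = (C * (h + 1) + 1) * (D + 1) * q ^ (ℓ + 2) := by ring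

/-! ### Membership in `𝒰` -/

theorem IsTripartite.hasExactTransversal {V : Type u} {G : ThreeGraph V} (h : G.IsTripartite) :
    G.HasExactTransversal := by
  obtain ⟨p, hp⟩ := h
  refine ⟨{v | p v = 0}, fun e he => le_antisymm (ncard_inter_le_one (hp e he) 0) ?_⟩
  have himg : e.image p = Finset.univ := by
    rw [← Finset.card_eq_iff_eq_univ, Finset.card_image_of_injOn (hp e he), G.card_edge e he,
      Fintype.card_fin]
  obtain ⟨v, hv, hv0⟩ := Finset.mem_image.1 (himg ▸ Finset.mem_univ (0 : Fin 3))
  exact (Set.ncard_pos (e.finite_toSet.inter_of_left _)).2 ⟨v, hv, hv0⟩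

theorem ULevel.succ {i : ℕ} {W : Type u} {G : ThreeGraph W} (h : ULevel i W G) :
    ULevel (i + 1) W G := by
  match i, h with
  | 0, h => exact IsTripartite.hasExactTransversal h
  | i + 1, h => exact RedClosure.base W G h

theorem ULevel.mono {i j : ℕ} (hij : i ≤ j) {W : Type u} {G : ThreeGraph W} (h : ULevel i W G) :
    ULevel j W G := by
  induction hij with
  | refl => exact h
  | step _ ih => exact ih.succ

theorem HasExactTransversal.inU {V : Type u} {G : ThreeGraph V} (h : G.HasExactTransversal) :
    G.InU :=
  ⟨1, h⟩

theorem IsCollapsible.inU {V : Type u} {G : ThreeGraph V} {U : Set V} (hU : G.IsCollapsible U)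
    (hH : (G.collapse U).InU) (hF : (G.induce U).InU) : G.InU := by
  obtain ⟨a, ha⟩ := hH
  obtain ⟨b, hb⟩ := hF
  exact ⟨a + b + 2, RedClosure.reduce V G U hU (ULevel.mono (by omega : a ≤ a + b + 1) ha)
    (RedClosure.base _ _ (ULevel.mono (by omega : b ≤ a + b + 1) hb))⟩

theorem collapse_hasExactTransversal {V : Type u} (G : ThreeGraph V) (U : Set V)
    (hU : ∀ e ∈ G.edges, ((e : Set V) ∩ U).Nonempty) : (G.collapse U).HasExactTransversal := by
  refine ⟨{none}, ?_⟩
  rintro e ⟨-, f, hf, hef⟩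
  obtain ⟨v, hv, hvU⟩ := hU f hf
  have hmem : none ∈ (e : Set (Option {v : V // v ∉ U})) := by
    rw [hef]
    exact ⟨v, hv, dif_pos hvU⟩
  rw [Set.inter_eq_right.2 (Set.singleton_subset_iff.2 hmem), Set.ncard_singleton]

/-- Every edge has two vertices on the same level and the third on a higher one. -/
theorem inU_of_pair_below {V : Type u} [Finite V] (G : ThreeGraph V) (f : V → ℕ)
    (hf : ∀ e ∈ G.edges, ∃ x ∈ e, ∃ y ∈ e, ∃ z ∈ e, x ≠ y ∧ f x = f y ∧ f x < f z) : G.InU := by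
  classical
  -- Let `R` be the set of vertices above the lowest level. An edge based on the lowest level meets
  -- `R` once, and any other edge lies in `R`. So collapsing `R` makes the new vertex an exact
  -- transversal, and `G[R]` is handled by induction.
  induction hn : Nat.card V using Nat.strong_induction_on generalizing V with
  | _ n ih =>
  subst hn
  rcases isEmpty_or_nonempty V with hV | hV
  · refine HasExactTransversal.inU ⟨∅, fun e he => ?_⟩
    obtain ⟨x, -⟩ := hf e he
    exact hV.elim x
  obtain ⟨v₀, hv₀⟩ := Finite.exists_min f
  set R : Set V := {v | f v₀ < f v} with hR
  have hinter : ∀ e ∈ G.edges, ((e : Set V) ∩ R).ncard = 1 ∨ (e : Set V) ⊆ R := by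
    intro e he
    obtain ⟨x, hx, y, hy, z, hz, hxy, hfxy, hfz⟩ := hf e he
    have hxz : x ≠ z := fun h => by simp [h] at hfz
    have hyz : y ≠ z := fun h => by simp [hfxy, h] at hfz
    have hexyz : e = {x, y, z} := by
      symm
      refine Finset.eq_of_subset_of_card_le ?_ ?_
      · intro w hw
        simp only [Finset.mem_insert, Finset.mem_singleton] at hw
        rcases hw with rfl | rfl | rfl <;> assumption
      · rw [G.card_edge e he, Finset.card_eq_three.2 ⟨x, y, z, hxy, hxz, hyz, rfl⟩]
    have hx0 := hv₀ x
    rcases hx0.eq_or_lt with h | h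
    · left
      rw [Set.ncard_eq_one]
      refine ⟨z, ?_⟩
      ext w
      simp only [hexyz, hR, Finset.coe_insert, Finset.coe_singleton, Set.mem_inter_iff,
        Set.mem_insert_iff, Set.mem_singleton_iff, Set.mem_ofPred_eq]
      constructor
      · rintro ⟨rfl | rfl | rfl, hw⟩
        · omega
        · omega
        · rfl
      · rintro rfl
        exact ⟨Or.inr (Or.inr rfl), by omega⟩
    · right
      intro w hw
      simp only [hexyz, Finset.coe_insert, Finset.coe_singleton, Set.mem_insert_iff,
        Set.mem_singleton_iff] at hw
      rcases hw with rfl | rfl | rfl <;> simp only [hR, Set.mem_ofPred_eq] <;> omega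
  have hsub : ∀ e ∈ G.edges, (e : Set V) ⊆ R → ((e : Set V) ∩ R).ncard = 3 := fun e he h => by
    rw [Set.inter_eq_left.2 h, Set.ncard_coe_finset, G.card_edge e he]
  rcases Nat.lt_or_ge R.ncard 2 with hlt | hge
  · refine HasExactTransversal.inU ⟨R, fun e he => (hinter e he).resolve_right fun h => ?_⟩
    have h1 := hsub e he h
    have h2 := Set.ncard_le_ncard (Set.inter_subset_right : (e : Set V) ∩ R ⊆ R) R.toFinite
    omega
  · have hRlt : R.ncard < Nat.card V := by
      rw [← Set.ncard_univ]
      exact Set.ncard_lt_ncard ⟨Set.subset_univ _, fun h => lt_irrefl (f v₀) (h (Set.mem_univ v₀))⟩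
    refine IsCollapsible.inU (U := R) ⟨hge, hRlt, fun e he => ?_⟩
      (collapse_hasExactTransversal G R fun e he => ?_).inU ?_
    · rcases hinter e he with h | h
      · omega
      · have := hsub e he h
        omega
    · refine Set.nonempty_of_ncard_ne_zero ?_
      rcases hinter e he with h | h
      · omega
      · have := hsub e he h
        omega
    · refine ih R.ncard hRlt (G.induce R) (fun v => f v) (fun e he => ?_) rfl
      obtain ⟨x, hx, y, hy, z, hz, hxy, hfxy, hfz⟩ := hf _ he
      obtain ⟨x, hxe, rfl⟩ := Finset.mem_map.1 hx
      obtain ⟨y, hye, rfl⟩ := Finset.mem_map.1 hy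
      obtain ⟨z, hze, rfl⟩ := Finset.mem_map.1 hz
      exact ⟨x, hxe, y, hye, z, hze, fun h => hxy (by rw [h]), hfxy, hfz⟩

/-! ### Squaring colourings: the double exponential lower bound -/

/-- The triples of `Fin N` have a coloring with `q` colors such that every `3`-graph with a
monochromatic copy belongs to `𝒰`. -/
def UColorable (q N : ℕ) : Prop :=
  ∃ χ : Finset (Fin N) → ℕ, (∀ e, e.card = 3 → χ e < q) ∧
    ∀ (c : ℕ) (V : Type u) [Finite V] (G : ThreeGraph V) (φ : V ↪ Fin N),
      (∀ e ∈ G.edges, χ (e.map φ) = c) → G.InU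

theorem uColorable_zero_two : UColorable.{u} 0 2 := by
  refine ⟨fun _ => 0, fun e he => ?_, fun c V _ G φ _ => ⟨0, fun v => Fin.castLE (by omega) (φ v),
    fun e _ => ?_⟩⟩
  · have := Finset.card_le_univ e
    simp [he] at this
  · exact ((Fin.castLE_injective _).comp φ.injective).injOn

theorem uColorable_one_three : UColorable.{u} 1 3 :=
  ⟨fun _ => 0, fun _ _ => zero_lt_one, fun _ _ _ _ φ _ => ⟨0, φ, fun _ _ => φ.injective.injOn⟩⟩

/-- This treats the old colours of the product colouring. An edge is either injective under `α` or
inside a fibre of `α`, so it never meets a fibre in exactly two vertices. Fibres are therefore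
collapsible, and both resulting graphs have the same form with fewer vertices. -/
theorem inU_of_fibered {N : ℕ} {χ : Finset (Fin N) → ℕ} {c : ℕ}
    (hχ : ∀ (V : Type u) [Finite V] (G : ThreeGraph V) (φ : V ↪ Fin N),
      (∀ e ∈ G.edges, χ (e.map φ) = c) → G.InU)
    {V : Type u} [Finite V] (G : ThreeGraph V) (α β : V → Fin N)
    (hαβ : ∀ v w, α v = α w → β v = β w → v = w)
    (hG : ∀ e ∈ G.edges, ((e.image α).card = 3 ∧ χ (e.image α) = c) ∨
      ((e.image α).card = 1 ∧ χ (e.image β) = c)) : G.InU := by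
  classical
  induction hn : Nat.card V using Nat.strong_induction_on generalizing V with
  | _ n ih =>
  subst hn
  have hconst : ∀ e : Finset V, (e.image α).card = 1 → ∀ v ∈ e, ∀ w ∈ e, α v = α w :=
    fun e he v hv w hw => Finset.card_le_one.1 he.le _ (Finset.mem_image_of_mem α hv) _
      (Finset.mem_image_of_mem α hw)
  have hinjOn : ∀ e ∈ G.edges, (e.image α).card = 3 → Set.InjOn α (e : Set V) :=
    fun e he h => Finset.card_image_iff.1 (h.trans (G.card_edge e he).symm)
  by_cases hfib : ∃ v₀ w₀, α v₀ ≠ α w₀ ∧ ∃ w₁, w₁ ≠ w₀ ∧ α w₁ = α w₀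
  · obtain ⟨v₀, w₀, hv₀, w₁, hw₁, hw₁₀⟩ := hfib
    set U : Set V := {v | α v = α w₀} with hU
    have hUlt : U.ncard < Nat.card V := by
      rw [← Set.ncard_univ]
      exact Set.ncard_lt_ncard ⟨Set.subset_univ _, fun h => hv₀ (h (Set.mem_univ v₀))⟩
    have hU2 : 2 ≤ U.ncard := by
      rw [← Set.ncard_pair hw₁]
      refine Set.ncard_le_ncard ?_ U.toFinite
      rintro x (rfl | rfl)
      · exact hw₁₀
      · rfl
    refine IsCollapsible.inU (U := U) ⟨hU2, hUlt, fun e he h2 => ?_⟩ ?_ ?_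
    · obtain ⟨x, y, hxy, hex⟩ := Set.ncard_eq_two.1 h2
      have hx : x ∈ (e : Set V) ∩ U := by rw [hex]; simp
      have hy : y ∈ (e : Set V) ∩ U := by rw [hex]; simp
      rcases hG e he with ⟨h, -⟩ | ⟨h, -⟩
      · exact hxy (hinjOn e he h hx.1 hy.1 (hx.2.trans hy.2.symm))
      · have hsub : (e : Set V) ⊆ U := fun z hz => (hconst e h z hz x hx.1).trans hx.2
        rw [Set.inter_eq_left.2 hsub, Set.ncard_coe_finset, G.card_edge e he] at h2
        omega
    · set α' : Option {v : V // v ∉ U} → Fin N := fun o => o.elim (α w₀) fun v => α v with hα'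
      set β' : Option {v : V // v ∉ U} → Fin N := fun o => o.elim (β w₀) fun v => β v with hβ'
      have hα'c : ∀ v, α' (collapseMap U v) = α v := by
        intro v
        by_cases h : v ∈ U
        · rw [collapseMap, dif_pos h]; exact Eq.symm h
        · rw [collapseMap, dif_neg h]; rfl
      have hβ'c : ∀ v, v ∉ U → β' (collapseMap U v) = β v := by
        intro v h
        rw [collapseMap, dif_neg h]; rfl
      have hcardlt : Nat.card (Option {v : V // v ∉ U}) < Nat.card V := by
        rw [Finite.card_option]
        have h1 : Nat.card {v : V // v ∉ U} = Uᶜ.ncard := rfl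
        have h2 := Set.ncard_add_ncard_compl U
        omega
      refine ih _ hcardlt (G.collapse U) α' β' ?_ ?_ rfl
      · rintro (_ | ⟨v, hv⟩) (_ | ⟨w, hw⟩) h h'
        · rfl
        · exact absurd h.symm hw
        · exact absurd h hv
        · have := hαβ v w h h'
          subst this
          rfl
      · rintro e ⟨he3, f, hf, hef⟩
        have hef' : e = f.image (collapseMap U) := by
          rw [← Finset.coe_inj, hef, Finset.coe_image]
        have himg : e.image α' = f.image α := by
          rw [hef', Finset.image_image]
          exact Finset.image_congr fun v _ => hα'c v
        rw [himg]
        rcases hG f hf with h | ⟨h, h'⟩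
        · exact Or.inl h
        · refine Or.inr ⟨h, ?_⟩
          -- An edge inside the collapsed fibre would have a one-point image, but `e` has three
          -- vertices.
          have hfU : ∀ v ∈ f, v ∉ U := by
            intro v hv hvU
            have hle : e.card ≤ 1 := by
              rw [hef', Finset.card_le_one]
              intro a ha b hb
              obtain ⟨a, haf, rfl⟩ := Finset.mem_image.1 ha
              obtain ⟨b, hbf, rfl⟩ := Finset.mem_image.1 hb
              have haU : a ∈ U := (hconst f h a haf v hv).trans hvU
              have hbU : b ∈ U := (hconst f h b hbf v hv).trans hvU
              rw [collapseMap, collapseMap, dif_pos haU, dif_pos hbU]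
            omega
          rw [← h', hef', Finset.image_image]
          congr 1
          exact Finset.image_congr fun v hv => hβ'c v (hfU v hv)
    · refine ih U.ncard hUlt (G.induce U) (fun v => α v) (fun v => β v)
        (fun v w h h' => Subtype.ext (hαβ _ _ h h')) (fun e he => ?_) rfl
      have := hG _ he
      rw [Finset.map_eq_image, Finset.image_image, Finset.image_image] at this
      exact this
  -- No proper fibre has two vertices, so `α` is injective or constant, and `α` or `β` respectively
  -- embeds `G` in the old colouring.
  · push Not at hfib
    by_cases hα : Function.Injective α
    · refine hχ V G ⟨α, hα⟩ fun e he => ?_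
      rw [Finset.map_eq_image]
      rcases hG e he with ⟨-, h⟩ | ⟨h, -⟩
      · exact h
      · rw [Finset.card_image_of_injective _ hα, G.card_edge e he] at h
        omega
    · simp only [Function.Injective, not_forall] at hα
      obtain ⟨w₁, w₀, hw, hne⟩ := hα
      have hall : ∀ v, α v = α w₀ := fun v => by
        by_contra h
        exact hfib v w₀ h w₁ hne hw
      refine hχ V G ⟨β, fun v w h => hαβ v w ((hall v).trans (hall w).symm) h⟩ fun e he => ?_
      rw [Finset.map_eq_image]
      rcases hG e he with ⟨h, -⟩ | ⟨-, h⟩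
      · have hle : (e.image α).card ≤ 1 := by
          rw [Finset.card_le_one]
          intro a ha b hb
          obtain ⟨a, -, rfl⟩ := Finset.mem_image.1 ha
          obtain ⟨b, -, rfl⟩ := Finset.mem_image.1 hb
          rw [hall a, hall b]
        omega
      · exact h

/-- Lexicographic product: triples across three blocks or inside one block inherit an old colour.
Triples split 2+1 get one of two new colours, according to whether the pair lies in the lower or the
higher block. -/
theorem UColorable.square {q N : ℕ} (h : UColorable.{u} q N) : UColorable.{u} (q + 2) (N * N) := by
  classical
  obtain ⟨χ, hχq, hχ⟩ := h
  let a : Fin (N * N) → Fin N := fun x => (finProdFinEquiv.symm x).1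
  let b : Fin (N * N) → Fin N := fun x => (finProdFinEquiv.symm x).2
  have hab : ∀ x y, a x = a y → b x = b y → x = y := fun x y h h' =>
    finProdFinEquiv.symm.injective (Prod.ext h h')
  let low : Finset (Fin (N * N)) → Prop := fun e =>
    ∃ x ∈ e, ∃ y ∈ e, ∃ z ∈ e, x ≠ y ∧ a x = a y ∧ a x < a z
  -- The inner value `0` is never taken on a triple, since `b` is injective within a block (`hb3`).
  let χ' : Finset (Fin (N * N)) → ℕ := fun e =>
    if (e.image a).card = 3 then χ (e.image a) else
    if (e.image a).card = 1 then (if (e.image b).card = 3 then χ (e.image b) else 0) else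
    if low e then q else q + 1
  have hb3 : ∀ e : Finset (Fin (N * N)), e.card = 3 → (e.image a).card = 1 →
      (e.image b).card = 3 := by
    intro e he h
    rw [Finset.card_image_of_injOn, he]
    intro x hx y hy hxy
    exact hab x y (Finset.card_le_one.1 h.le _ (Finset.mem_image_of_mem a hx) _
      (Finset.mem_image_of_mem a hy)) hxy
  refine ⟨χ', fun e he => ?_, fun c V _ G φ hG => ?_⟩
  · by_cases h3 : (e.image a).card = 3
    · simp only [χ', if_pos h3]
      have := hχq _ h3
      omega
    · by_cases h1 : (e.image a).card = 1
      · simp only [χ', if_neg h3, if_pos h1, if_pos (hb3 e he h1)]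
        have := hχq _ (hb3 e he h1)
        omega
      · simp only [χ', if_neg h3, if_neg h1]
        split_ifs <;> omega
  · have hcard : ∀ e ∈ G.edges, (e.map φ).card = 3 := fun e he => by
      rw [Finset.card_map, G.card_edge e he]
    have himg : ∀ (e : Finset V) (g : Fin (N * N) → Fin N),
        (e.map φ).image g = e.image fun v => g (φ v) := fun e g => by
      rw [Finset.map_eq_image, Finset.image_image]
      rfl
    by_cases hc : c < q
    · refine inU_of_fibered (hχ c) G (fun v => a (φ v)) (fun v => b (φ v))
        (fun v w h h' => φ.injective (hab _ _ h h')) fun e he => ?_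
      have hcol := hG e he
      rw [← himg, ← himg]
      by_cases h3 : ((e.map φ).image a).card = 3
      · simp only [χ', if_pos h3] at hcol
        exact Or.inl ⟨h3, hcol⟩
      · by_cases h1 : ((e.map φ).image a).card = 1
        · simp only [χ', if_neg h3, if_pos h1, if_pos (hb3 _ (hcard e he) h1)] at hcol
          exact Or.inr ⟨h1, hcol⟩
        · simp only [χ', if_neg h3, if_neg h1] at hcol
          split_ifs at hcol <;> omega
    · have key : ∀ e ∈ G.edges, (∃ x ∈ e, ∃ y ∈ e, ∃ z ∈ e, x ≠ y ∧ a (φ x) = a (φ y) ∧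
          a (φ x) ≠ a (φ z)) ∧ (c = q ↔ low (e.map φ)) := by
        intro e he
        have hcol := hG e he
        have h3 : ((e.map φ).image a).card ≠ 3 := fun h3 => by
          simp only [χ', if_pos h3] at hcol
          have := hχq _ h3
          omega
        have h1 : ((e.map φ).image a).card ≠ 1 := fun h1 => by
          simp only [χ', if_neg h3, if_pos h1, if_pos (hb3 _ (hcard e he) h1)] at hcol
          have := hχq _ (hb3 _ (hcard e he) h1)
          omega
        constructor
        · have hnotinj : ¬ Set.InjOn (fun v => a (φ v)) (e : Set V) := fun hinj => h3 (by
            rw [himg, Finset.card_image_of_injOn hinj, G.card_edge e he])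
          simp only [Set.InjOn, not_forall] at hnotinj
          obtain ⟨x, hx, y, hy, hxy, hne⟩ := hnotinj
          by_contra hno
          push Not at hno
          refine h1 ?_
          rw [Finset.card_eq_one]
          refine ⟨a (φ x), ?_⟩
          rw [himg]
          ext w
          simp only [Finset.mem_image, Finset.mem_singleton]
          constructor
          · rintro ⟨z, hz, rfl⟩
            exact (hno x hx y hy z hz hne hxy).symm
          · rintro rfl
            exact ⟨x, hx, rfl⟩
        · simp only [χ', if_neg h3, if_neg h1] at hcol
          split_ifs at hcol with hlow
          · exact ⟨fun _ => hlow, fun _ => hcol.symm⟩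
          · exact ⟨fun h => by omega, fun h => absurd h hlow⟩
      by_cases hcq : c = q
      · refine inU_of_pair_below G (fun v => (a (φ v) : ℕ)) fun e he => ?_
        obtain ⟨x, hx, y, hy, z, hz, hxy, h, hlt⟩ := (key e he).2.1 hcq
        obtain ⟨x, hxe, rfl⟩ := Finset.mem_map.1 hx
        obtain ⟨y, hye, rfl⟩ := Finset.mem_map.1 hy
        obtain ⟨z, hze, rfl⟩ := Finset.mem_map.1 hz
        exact ⟨x, hxe, y, hye, z, hze, fun h => hxy (by rw [h]), congrArg Fin.val h, hlt⟩
      -- In the other new colour the pair lies in the higher block, so the levels are reversed.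
      · refine inU_of_pair_below G (fun v => N - (a (φ v) : ℕ)) fun e he => ?_
        obtain ⟨⟨x, hx, y, hy, z, hz, hxy, h, hne⟩, hlow⟩ := key e he
        refine ⟨x, hx, y, hy, z, hz, hxy, by rw [h], ?_⟩
        have hnlt : ¬ a (φ x) < a (φ z) := fun hlt => hcq (hlow.2 ⟨φ x, Finset.mem_map_of_mem φ hx,
          φ y, Finset.mem_map_of_mem φ hy, φ z, Finset.mem_map_of_mem φ hz,
          fun h => hxy (φ.injective h), h, hlt⟩)
        have h1 : a (φ z) < a (φ x) := lt_of_le_of_ne (not_lt.1 hnlt) (Ne.symm hne)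
        have h2 := (a (φ x)).2
        have h3 : (a (φ z) : ℕ) < a (φ x) := h1
        omega

theorem UColorable.iterate_square {q N : ℕ} (h : UColorable.{u} q N) (k : ℕ) :
    UColorable.{u} (q + 2 * k) (N ^ 2 ^ k) := by
  induction k with
  | zero => simpa using h
  | succ k ih =>
    have := ih.square
    rwa [← pow_two, ← pow_mul, ← pow_succ] at this

theorem UColorable.lt_of_arrows {q M N : ℕ} (h : UColorable.{u} q M) {V : Type u} [Finite V]
    {G : ThreeGraph V} (hG : ¬ G.InU) (hN : G.Arrows q N) : M < N := by
  by_contra! hle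
  obtain ⟨χ, hχq, hχ⟩ := h
  obtain ⟨c, φ, hφ⟩ := hN fun s => ⟨χ (s.1.map (Fin.castLEEmb hle)),
    hχq _ (by rw [Finset.card_map, s.2])⟩
  refine hG (hχ c V G (φ.trans (Fin.castLEEmb hle)) fun e he => ?_)
  rw [← hφ e he, ← Finset.map_map]

/-! ### Lower bounds from 3-partitions and from rainbow colourings -/

/-- One fixed injection of `e` into the parts, extended arbitrarily, already accounts for a fraction
1/27 of all maps. -/
theorem card_filter_injOn_ge {N : ℕ} (e : Finset (Fin N)) (he : e.card = 3) :
    3 ^ N ≤ 27 * Fintype.card {g : Fin N → Fin 3 // Set.InjOn g (e : Set (Fin N))} := by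
  classical
  have hN : 3 ≤ N := by
    have := Finset.card_le_univ e
    rwa [he, Fintype.card_fin] at this
  obtain ⟨σ⟩ : Nonempty (e ↪ Fin 3) :=
    Function.Embedding.nonempty_of_card_le (by simp [he])
  let F : ({v // v ∉ e} → Fin 3) → {g : Fin N → Fin 3 // Set.InjOn g (e : Set (Fin N))} :=
    fun g => ⟨fun v => if h : v ∈ e then σ ⟨v, h⟩ else g ⟨v, h⟩, fun v hv w hw hvw => by
      have hv' : v ∈ e := hv
      have hw' : w ∈ e := hw
      simp only [hv', hw', dite_true] at hvw
      exact congrArg Subtype.val (σ.injective hvw)⟩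
  have hF : Function.Injective F := by
    intro g g' h
    funext v
    have := congrFun (congrArg Subtype.val h) v
    simpa only [F, v.2, dite_false] using this
  have h1 := Fintype.card_le_of_injective F hF
  rw [Fintype.card_fun, Fintype.card_fin, Fintype.card_subtype_compl, Fintype.card_fin,
    Fintype.card_coe, he] at h1
  calc 3 ^ N = 27 * 3 ^ (N - 3) := by
        rw [show 27 = 3 ^ 3 by norm_num, ← pow_add, Nat.add_sub_cancel' hN]
    _ ≤ _ := Nat.mul_le_mul_left _ h1

-- Averaging over all maps `g`: every triple is separated by at least 1/27 of them, so some `g`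
-- separates at least 1/27 of the triples.
open Classical in
theorem exists_separating {N : ℕ} (𝒯 : Finset (Finset (Fin N))) (h𝒯 : ∀ e ∈ 𝒯, e.card = 3) :
    ∃ g : Fin N → Fin 3,
      27 * (𝒯.filter fun e : Finset (Fin N) => ¬ Set.InjOn g (e : Set (Fin N))).card ≤ 26 * 𝒯.card := by
  by_contra! hno
  have hsplit : ∀ g : Fin N → Fin 3,
      27 * (𝒯.filter fun e : Finset (Fin N) => Set.InjOn g (e : Set (Fin N))).card < 𝒯.card := fun g => by
    have h1 := hno g
    have h2 := Finset.card_filter_add_card_filter_not (s := 𝒯)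
      (fun e : Finset (Fin N) => Set.InjOn g (e : Set (Fin N)))
    omega
  have hlt := Finset.sum_lt_sum_of_nonempty (s := (Finset.univ : Finset (Fin N → Fin 3)))
    Finset.univ_nonempty fun g _ => hsplit g
  have hle : ∑ _g : Fin N → Fin 3, 𝒯.card ≤
      ∑ g : Fin N → Fin 3, 27 * (𝒯.filter fun e : Finset (Fin N) => Set.InjOn g (e : Set (Fin N))).card := by
    simp_rw [Finset.card_filter, Finset.mul_sum]
    rw [Finset.sum_comm, Finset.sum_const, Finset.card_univ, Fintype.card_fun, Fintype.card_fin,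
      Fintype.card_fin, smul_eq_mul, mul_comm, ← smul_eq_mul, ← Finset.sum_const]
    refine Finset.sum_le_sum fun e he => ?_
    refine (card_filter_injOn_ge e (h𝒯 e he)).trans (le_of_eq ?_)
    rw [← Finset.mul_sum, ← Finset.card_filter, Fintype.card_subtype]
  omega

open Classical in
theorem exists_separating_family {N : ℕ} (𝒯 : Finset (Finset (Fin N)))
    (h𝒯 : ∀ e ∈ 𝒯, e.card = 3) (q : ℕ) : ∃ f : Fin q → Fin N → Fin 3,
      27 ^ q * (𝒯.filter fun e : Finset (Fin N) => ∀ i, ¬ Set.InjOn (f i) (e : Set (Fin N))).card ≤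
        26 ^ q * 𝒯.card := by
  induction q with
  | zero => exact ⟨Fin.elim0, by simp⟩
  | succ q ih =>
    obtain ⟨f, hf⟩ := ih
    set 𝒯' := 𝒯.filter fun e : Finset (Fin N) => ∀ i, ¬ Set.InjOn (f i) (e : Set (Fin N)) with h𝒯'
    obtain ⟨g, hg⟩ := exists_separating 𝒯' fun e he => h𝒯 e (Finset.mem_of_mem_filter e he)
    refine ⟨Fin.cons g f, ?_⟩
    have heq : (𝒯.filter fun e : Finset (Fin N) => ∀ i, ¬ Set.InjOn
        ((Fin.cons g f : Fin (q + 1) → Fin N → Fin 3) i) (e : Set (Fin N))) =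
        𝒯'.filter fun e : Finset (Fin N) => ¬ Set.InjOn g (e : Set (Fin N)) := by
      rw [h𝒯', Finset.filter_filter]
      refine Finset.filter_congr fun e _ => ?_
      rw [Fin.forall_fin_succ]
      simp only [Fin.cons_zero, Fin.cons_succ]
      exact and_comm
    rw [heq]
    calc 27 ^ (q + 1) * (𝒯'.filter fun e : Finset (Fin N) => ¬ Set.InjOn g (e : Set (Fin N))).card
        = 27 ^ q * (27 * (𝒯'.filter fun e : Finset (Fin N) => ¬ Set.InjOn g (e : Set (Fin N))).card) := by ring
      _ ≤ 27 ^ q * (26 * 𝒯'.card) := Nat.mul_le_mul_left _ hg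
      _ = 26 * (27 ^ q * 𝒯'.card) := by ring
      _ ≤ 26 * (26 ^ q * 𝒯.card) := Nat.mul_le_mul_left _ hf
      _ = 26 ^ (q + 1) * 𝒯.card := by ring

theorem card_triples_le (N : ℕ) :
    ((Finset.univ : Finset (Fin N)).powersetCard 3).card ≤ N ^ 3 := by
  rw [Finset.card_powersetCard, Finset.card_univ, Fintype.card_fin]
  exact Nat.choose_le_pow N 3

/-- Otherwise `q` partitions separate all triples. Colouring each triple by a partition that
separates it makes every colour class tripartite. -/
theorem pow_le_of_arrows_of_not_isTripartite {V : Type u} {G : ThreeGraph V}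
    (hG : ¬ G.IsTripartite) {q N : ℕ} (hN : G.Arrows q N) : 27 ^ q ≤ 26 ^ q * N ^ 3 := by
  classical
  by_contra! hlt
  obtain ⟨f, hf⟩ := exists_separating_family ((Finset.univ : Finset (Fin N)).powersetCard 3)
    (fun e he => (Finset.mem_powersetCard.1 he).2) q
  have hsep : ∀ s : {s : Finset (Fin N) // s.card = 3}, ∃ i, Set.InjOn (f i) (s.1 : Set (Fin N)) := by
    by_contra! hno
    obtain ⟨s, hs⟩ := hno
    have hpos : 0 < (((Finset.univ : Finset (Fin N)).powersetCard 3).filter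
        fun e : Finset (Fin N) => ∀ i, ¬ Set.InjOn (f i) (e : Set (Fin N))).card :=
      Finset.card_pos.2 ⟨s.1, Finset.mem_filter.2
        ⟨Finset.mem_powersetCard.2 ⟨Finset.subset_univ _, s.2⟩, hs⟩⟩
    have h1 := Nat.mul_le_mul_left (26 ^ q) (card_triples_le N)
    have h2 := Nat.le_mul_of_pos_right (27 ^ q) hpos
    omega
  choose i hi using hsep
  obtain ⟨c, φ, hφ⟩ := hN i
  refine hG ⟨fun v => f c (φ v), fun e he v hv w hw hvw => φ.injective ?_⟩
  have := hi ⟨e.map φ, (Finset.card_map φ).trans (G.card_edge e he)⟩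
  rw [hφ e he] at this
  exact this (Finset.mem_coe.2 (Finset.mem_map_of_mem φ hv))
    (Finset.mem_coe.2 (Finset.mem_map_of_mem φ hw)) hvw

theorem lt_pow_three_of_arrows {V : Type u} {G : ThreeGraph V} (hG : 2 ≤ G.edges.ncard)
    {q N : ℕ} (hN : G.Arrows q N) : q < N ^ 3 := by
  classical
  by_contra! hle
  -- With enough colours all triples get different ones, so no graph with two edges is
  -- monochromatic.
  obtain ⟨χ⟩ : Nonempty ({s : Finset (Fin N) // s.card = 3} ↪ Fin q) :=
    Function.Embedding.nonempty_of_card_le (by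
      rw [Fintype.card_finset_len, Fintype.card_fin, Fintype.card_fin]
      exact (Nat.choose_le_pow N 3).trans hle)
  obtain ⟨c, φ, hφ⟩ := hN χ
  obtain ⟨e, he, e', he', hne⟩ := (Set.one_lt_ncard (Set.finite_of_ncard_pos (by omega))).1 hG
  have := χ.injective ((hφ e he).trans (hφ e' he').symm)
  exact hne (Finset.map_injective φ (congrArg Subtype.val this))

/-! ### Bounds for the Ramsey numbers -/

theorem OffDiagArrows.arrows {V : Type u} {G : ThreeGraph V} {q N : ℕ} (hq : 0 < q)
    (h : OffDiagArrows (fun _ : Fin q => ⟨V, G⟩) N) : G.Arrows q N := by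
  intro χ
  obtain ⟨c, φ, hφ⟩ := h (Fin N) (fun s => if hs : s.card = 3 then χ ⟨s, hs⟩ else ⟨0, hq⟩) (by simp)
  refine ⟨c, φ, fun e he => ?_⟩
  rw [← hφ e he, dif_pos]

theorem arrows_tower {V : Type u} [Finite V] (G : ThreeGraph V) {q : ℕ} (hq : 0 < q) :
    G.Arrows q ((q + 1) ^ ((q + 1) ^ (q * Nat.card V) * (q + 1) ^ (q * Nat.card V))) :=
  (offDiagArrows_all (fun _ : Fin q => ⟨V, G⟩) (fun _ => ‹Finite V›) (Nat.card V)
    fun _ => le_rfl).arrows hq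

theorem ramseyNumber_le {V : Type u} {G : ThreeGraph V} {q N : ℕ} (h : G.Arrows q N) :
    G.ramseyNumber q ≤ N :=
  Nat.sInf_le h

theorem arrows_ramseyNumber {V : Type u} [Finite V] (G : ThreeGraph V) {q : ℕ} (hq : 0 < q) :
    G.Arrows q (G.ramseyNumber q) :=
  Nat.sInf_mem (s := {N | G.Arrows q N}) ⟨_, arrows_tower G hq⟩

theorem InULevel.exists_ramseyNumber_le {V : Type u} [Finite V] [Nonempty V] {G : ThreeGraph V}
    {ℓ : ℕ} (h : G.InULevel ℓ) : ∃ C, ∀ q, 2 ≤ q → G.ramseyNumber q ≤ q ^ (C * q ^ ℓ) := by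
  obtain ⟨C, hC⟩ := offDiagArrows_uLevel ℓ {(⟨V, G⟩ : Σ W : Type u, ThreeGraph W)}
    (Set.finite_singleton _) (by rintro _ rfl; exact ⟨‹_›, ‹_›, h⟩)
  exact ⟨C, fun q hq => ramseyNumber_le ((hC q hq _ fun _ => rfl).arrows (by omega))⟩

theorem natCast_pow_le_two_rpow {q n : ℕ} {y : ℝ} (hq : 0 < q)
    (h : n * Real.log q ≤ y * Real.log 2) : (q : ℝ) ^ n ≤ 2 ^ y := by
  have hq' : (0 : ℝ) < q := by exact_mod_cast hq
  rw [← Real.rpow_natCast, Real.rpow_def_of_pos hq', Real.rpow_def_of_pos two_pos]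
  exact Real.exp_le_exp.2 (by linarith)

theorem rpow_third_le_ramseyNumber {V : Type u} [Finite V] {G : ThreeGraph V}
    (hG : 2 ≤ G.edges.ncard) {q : ℕ} (hq : 0 < q) :
    (q : ℝ) ^ (1 / 3 : ℝ) ≤ G.ramseyNumber q := by
  have h := lt_pow_three_of_arrows hG (arrows_ramseyNumber G hq)
  have h' : (q : ℝ) ≤ (G.ramseyNumber q : ℝ) ^ (3 : ℕ) := by exact_mod_cast h.le
  calc (q : ℝ) ^ (1 / 3 : ℝ) ≤ ((G.ramseyNumber q : ℝ) ^ (3 : ℕ)) ^ (1 / 3 : ℝ) :=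
        Real.rpow_le_rpow (by positivity) h' (by norm_num)
    _ = G.ramseyNumber q := by
        rw [← Real.rpow_natCast, ← Real.rpow_mul (by positivity)]
        norm_num

theorem two_rpow_le_ramseyNumber {V : Type u} [Finite V] {G : ThreeGraph V}
    (hG : ¬ G.IsTripartite) {q : ℕ} (hq : 0 < q) :
    (2 : ℝ) ^ (1 / 300 * (q : ℝ)) ≤ G.ramseyNumber q := by
  set N := G.ramseyNumber q with hN
  have h : 27 ^ q ≤ 26 ^ q * N ^ 3 :=
    pow_le_of_arrows_of_not_isTripartite hG (arrows_ramseyNumber G hq)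
  -- The hundredth power is taken because `2 * 26 ^ 100 ≤ 27 ^ 100`; with the cube of `N` this gives
  -- the exponent 300.
  have h2 : 2 ^ q ≤ N ^ 300 := by
    have h3 : 2 ^ q * (26 ^ q) ^ 100 ≤ N ^ 300 * (26 ^ q) ^ 100 := by
      calc 2 ^ q * (26 ^ q) ^ 100 = (2 * 26 ^ 100) ^ q := by
            rw [mul_pow, ← pow_mul, ← pow_mul, mul_comm q]
        _ ≤ (27 ^ 100) ^ q := Nat.pow_le_pow_left (by norm_num) q
        _ = (27 ^ q) ^ 100 := by rw [← pow_mul, ← pow_mul, mul_comm]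
        _ ≤ (26 ^ q * N ^ 3) ^ 100 := Nat.pow_le_pow_left h 100
        _ = N ^ 300 * (26 ^ q) ^ 100 := by rw [mul_pow, ← pow_mul N, mul_comm]
    exact Nat.le_of_mul_le_mul_right h3 (by positivity)
  have h' : (2 : ℝ) ^ q ≤ (N : ℝ) ^ (300 : ℕ) := by exact_mod_cast h2
  calc (2 : ℝ) ^ (1 / 300 * (q : ℝ)) = ((2 : ℝ) ^ q) ^ (1 / 300 : ℝ) := by
        rw [← Real.rpow_natCast, ← Real.rpow_mul (by positivity), mul_comm]
    _ ≤ ((N : ℝ) ^ (300 : ℕ)) ^ (1 / 300 : ℝ) :=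
        Real.rpow_le_rpow (by positivity) h' (by norm_num)
    _ = N := by
        rw [← Real.rpow_natCast, ← Real.rpow_mul (by positivity)]
        norm_num

/-- Even `q` starts the squaring from two vertices and no colours, odd `q` from three vertices and
one colour. In the odd case `2 ^ √2 ≤ 3` supplies the half-integer exponent. -/
theorem two_rpow_two_rpow_le_ramseyNumber {V : Type u} [Finite V] {G : ThreeGraph V}
    (hG : ¬ G.InU) {q : ℕ} (hq : 0 < q) :
    (2 : ℝ) ^ ((2 : ℝ) ^ ((q : ℝ) / 2)) ≤ G.ramseyNumber q := by
  have harr := arrows_ramseyNumber G hq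
  rcases Nat.even_or_odd' q with ⟨k, rfl | rfl⟩
  · have h := uColorable_zero_two.{u}.iterate_square k
    rw [zero_add] at h
    have hlt := (h.lt_of_arrows hG harr).le
    have hexp : ((2 * k : ℕ) : ℝ) / 2 = k := by push_cast; ring
    rw [hexp, Real.rpow_natCast, show ((2 : ℝ) ^ k) = ((2 ^ k : ℕ) : ℝ) by push_cast; rfl,
      Real.rpow_natCast]
    exact_mod_cast hlt
  · have h := uColorable_one_three.{u}.iterate_square k
    rw [add_comm] at h
    have hlt := (h.lt_of_arrows hG harr).le
    have hexp : ((2 * k + 1 : ℕ) : ℝ) / 2 = 1 / 2 + k := by push_cast; ring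
    have hsqrt : (2 : ℝ) ^ (1 / 2 : ℝ) ≤ 3 / 2 := by
      rw [← Real.sqrt_eq_rpow, Real.sqrt_le_left (by norm_num)]
      norm_num
    have hbase : (2 : ℝ) ^ ((2 : ℝ) ^ (1 / 2 : ℝ)) ≤ 3 := by
      calc (2 : ℝ) ^ ((2 : ℝ) ^ (1 / 2 : ℝ)) ≤ 2 ^ (3 / 2 : ℝ) :=
            Real.rpow_le_rpow_of_exponent_le (by norm_num) hsqrt
        _ = 2 * 2 ^ (1 / 2 : ℝ) := by
            rw [show (3 / 2 : ℝ) = 1 + 1 / 2 by norm_num, Real.rpow_add two_pos, Real.rpow_one]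
        _ ≤ 3 := by linarith
    calc (2 : ℝ) ^ ((2 : ℝ) ^ (((2 * k + 1 : ℕ) : ℝ) / 2))
        = ((2 : ℝ) ^ ((2 : ℝ) ^ (1 / 2 : ℝ))) ^ 2 ^ k := by
          rw [hexp, Real.rpow_add two_pos, Real.rpow_natCast, Real.rpow_mul two_pos.le,
            show ((2 : ℝ) ^ k) = ((2 ^ k : ℕ) : ℝ) by push_cast; rfl, Real.rpow_natCast]
      _ ≤ 3 ^ 2 ^ k := pow_le_pow_left₀ (by positivity) hbase _
      _ ≤ _ := by exact_mod_cast hlt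

theorem ramseyNumber_le_two_rpow_two_rpow {V : Type u} [Finite V] (G : ThreeGraph V) {q : ℕ}
    (hq : 2 ≤ q) : (G.ramseyNumber q : ℝ) ≤ (2 : ℝ) ^ ((2 : ℝ) ^
      ((4 * Nat.card V + 1) / Real.log 2 * ((q : ℝ) * Real.log (q : ℝ)))) := by
  set t := Nat.card V with ht
  have hle := ramseyNumber_le (arrows_tower G (q := q) (by omega))
  have h1 : q + 1 ≤ 2 ^ q := Nat.lt_two_pow_self
  have h2 : q + 1 ≤ q ^ 2 := by nlinarith
  -- The outer base is bounded by `2 ^ q`, the inner ones by `q ^ 2`; the stray factor `q` is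
  -- absorbed in `q ^ q`.
  have h3 : (q + 1) ^ ((q + 1) ^ (q * t) * (q + 1) ^ (q * t)) ≤ 2 ^ q ^ ((4 * t + 1) * q) := by
    calc (q + 1) ^ ((q + 1) ^ (q * t) * (q + 1) ^ (q * t))
        ≤ (2 ^ q) ^ ((q + 1) ^ (q * t) * (q + 1) ^ (q * t)) := Nat.pow_le_pow_left h1 _
      _ = 2 ^ (q * ((q + 1) ^ (q * t) * (q + 1) ^ (q * t))) := by rw [← pow_mul]
      _ ≤ 2 ^ (q ^ q * ((q ^ 2) ^ (q * t) * (q ^ 2) ^ (q * t))) := by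
          refine Nat.pow_le_pow_right two_pos (Nat.mul_le_mul (Nat.le_self_pow (by omega) q) ?_)
          exact Nat.mul_le_mul (Nat.pow_le_pow_left h2 _) (Nat.pow_le_pow_left h2 _)
      _ = 2 ^ q ^ ((4 * t + 1) * q) := by ring
  have hlog : 0 < Real.log 2 := Real.log_pos (by norm_num)
  calc (G.ramseyNumber q : ℝ) ≤ ((2 ^ q ^ ((4 * t + 1) * q) : ℕ) : ℝ) := by
        exact_mod_cast hle.trans h3
    _ = (2 : ℝ) ^ ((q : ℝ) ^ ((4 * t + 1) * q)) := by
        rw [← Nat.cast_pow q, Real.rpow_natCast, Nat.cast_pow, Nat.cast_ofNat]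
    _ ≤ _ := by
        refine Real.rpow_le_rpow_of_exponent_le (by norm_num)
          (natCast_pow_le_two_rpow (by omega) (le_of_eq ?_))
        push_cast
        field_simp

end ThreeGraph

theorem theorem1 {V : Type u} [Finite V] (G : ThreeGraph V) (hG : 2 ≤ G.edges.ncard) :
    -- the Ramsey numbers are finite
    (∀ q : ℕ, 1 ≤ q → ∃ N : ℕ, G.Arrows q N) ∧
    -- (a)
    (G.InULevel 0 → ∃ c C : ℝ, 0 < c ∧ 0 < C ∧ ∀ q : ℕ, 2 ≤ q →
      (q : ℝ) ^ c ≤ (G.ramseyNumber q : ℝ) ∧ (G.ramseyNumber q : ℝ) ≤ (q : ℝ) ^ C) ∧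
    -- (b)
    (G.InU ∧ ¬ G.InULevel 0 → ∃ c C : ℝ, 0 < c ∧ 0 < C ∧ ∀ q : ℕ, 2 ≤ q →
      (2 : ℝ) ^ (c * (q : ℝ)) ≤ (G.ramseyNumber q : ℝ) ∧
      (G.ramseyNumber q : ℝ) ≤ (2 : ℝ) ^ ((q : ℝ) ^ C)) ∧
    -- (b), the more precise upper bound
    (∀ ℓ : ℕ, G.InULevel ℓ → ∃ C : ℝ, 0 < C ∧ ∀ q : ℕ, 2 ≤ q →
      (G.ramseyNumber q : ℝ) ≤ (2 : ℝ) ^ (C * ((q : ℝ) ^ ℓ * Real.log (q : ℝ)))) ∧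
    -- (c)
    (¬ G.InU →
      (∀ q : ℕ, 1 ≤ q → (2 : ℝ) ^ ((2 : ℝ) ^ ((q : ℝ) / 2)) ≤ (G.ramseyNumber q : ℝ)) ∧
      ∃ C : ℝ, 0 < C ∧ ∀ q : ℕ, 2 ≤ q →
        (G.ramseyNumber q : ℝ) ≤
          (2 : ℝ) ^ ((2 : ℝ) ^ (C * ((q : ℝ) * Real.log (q : ℝ))))) := by
  have hlog : 0 < Real.log 2 := Real.log_pos (by norm_num)
  have hV : Nonempty V := by
    obtain ⟨e, he⟩ := Set.nonempty_of_ncard_ne_zero (by omega : G.edges.ncard ≠ 0)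
    obtain ⟨v, -⟩ := Finset.card_pos.1 (by rw [G.card_edge e he]; norm_num : 0 < e.card)
    exact ⟨v⟩
  refine ⟨fun q hq => ⟨_, G.arrows_tower hq⟩, fun h0 => ?_, fun ⟨⟨ℓ, hℓ⟩, h0⟩ => ?_,
    fun ℓ hℓ => ?_, fun hU => ⟨fun q hq => ThreeGraph.two_rpow_two_rpow_le_ramseyNumber hU hq,
      (4 * Nat.card V + 1) / Real.log 2, by positivity,
      fun q hq => G.ramseyNumber_le_two_rpow_two_rpow hq⟩⟩
  · obtain ⟨C, hC⟩ := h0.exists_ramseyNumber_le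
    -- `C` may be zero, and the exponent has to be positive.
    refine ⟨1 / 3, (C + 1 : ℕ), by norm_num, by positivity, fun q hq =>
      ⟨ThreeGraph.rpow_third_le_ramseyNumber hG (by omega), ?_⟩⟩
    rw [Real.rpow_natCast]
    have h1 := hC q hq
    rw [pow_zero, mul_one] at h1
    exact_mod_cast h1.trans (Nat.pow_le_pow_right (by omega) (Nat.le_succ C))
  · obtain ⟨C, hC⟩ := hℓ.exists_ramseyNumber_le
    refine ⟨1 / 300, (C + ℓ + 1 : ℕ), by norm_num, by positivity, fun q hq =>
      ⟨ThreeGraph.two_rpow_le_ramseyNumber h0 (by omega), ?_⟩⟩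
    have h1 : q ^ (C * q ^ ℓ) ≤ 2 ^ q ^ (C + ℓ + 1) := by
      calc q ^ (C * q ^ ℓ) ≤ (2 ^ q) ^ (C * q ^ ℓ) :=
            Nat.pow_le_pow_left Nat.lt_two_pow_self.le _
        _ = 2 ^ (C * q ^ (ℓ + 1)) := by rw [← pow_mul]; ring_nf
        _ ≤ 2 ^ (q ^ C * q ^ (ℓ + 1)) :=
            Nat.pow_le_pow_right two_pos (Nat.mul_le_mul_right _ (Nat.lt_pow_self hq).le)
        _ = 2 ^ q ^ (C + ℓ + 1) := by ring
    rw [Real.rpow_natCast, ← Nat.cast_pow q, Real.rpow_natCast]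
    exact_mod_cast (hC q hq).trans h1
  · obtain ⟨C, hC⟩ := hℓ.exists_ramseyNumber_le
    refine ⟨(C + 1) / Real.log 2, by positivity, fun q hq => ?_⟩
    have h1 : (G.ramseyNumber q : ℝ) ≤ (q : ℝ) ^ (C * q ^ ℓ) := by exact_mod_cast hC q hq
    refine h1.trans (ThreeGraph.natCast_pow_le_two_rpow (by omega) ?_)
    have hq1 : (1 : ℝ) ≤ q := by exact_mod_cast (by omega : 1 ≤ q)
    have h2 : 0 ≤ (q : ℝ) ^ ℓ * Real.log q := mul_nonneg (by positivity) (Real.log_nonneg hq1)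
    have h3 : (C + 1) / Real.log 2 * ((q : ℝ) ^ ℓ * Real.log q) * Real.log 2 =
        (C + 1) * ((q : ℝ) ^ ℓ * Real.log q) := by field_simp
    rw [h3]
    push_cast
    linarith
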